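/- For $t>0$ that is not the ordinate of a zero of the Riemann zeta-function $\zeta(s)$, let $$S(t)=\frac1\pi\,\Im\log\zeta\big(\tfrac12+it\big),$$ where the branch of the logarithm is obtained by continuous variation along the line segments joining the points $2$, $2+it$ and $\tfrac12+it$, starting with $\arg\zeta(2)=0$. If $t>0$ is the ordinate of a zero of $\zeta(s)$, let $$S(t)=\frac12\lim_{\varepsilon\to0}\big\{S(t+\varepsilon)+S(t-\varepsilon)\big\}.$$ Assume the Riemann Hypothesis. Then, as $t\to\infty$, $$S(t)=\Omega_\pm\!\left(\sqrt{\frac{\log t}{\log\log t}}\right),$$ that is, there is a constant $c>0$ such that each of the inequalities $$S(t)\ge c\sqrt{\frac{\log t}{\log\log t}}\qquad\text{and}\qquad S(t)\le -c\sqrt{\frac{\log t}{\log\log t}}$$ holds for arbitrarily large values of $t$. -/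

import Mathlib

open Filter Topology Set

/-- The broken line from `2` through `2 + it` to `1/2 + it`, parametrized by `u ∈ [0, 2]`:
vertical for `u ∈ [0, 1]`, horizontal for `u ∈ [1, 2]`. -/
noncomputable def zetaPath (t u : ℝ) : ℂ :=
  if u ≤ 1 then 2 + (u * t : ℝ) * Complex.I
  else (2 - 3 / 2 * (u - 1) : ℝ) + (t : ℝ) * Complex.I

/-- `l` is the logarithm of `ζ` obtained by continuous variation along the broken line from `2`
through `2 + it` to `1/2 + it`, starting with `arg ζ(2) = 0`. -/
structure IsLogZetaAlong (t : ℝ) (l : ℝ → ℂ) : Prop where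
  continuousOn : ContinuousOn l (Icc 0 2)
  exp_eq : ∀ u ∈ Icc (0 : ℝ) 2, Complex.exp (l u) = riemannZeta (zetaPath t u)
  im_zero : (l 0).im = 0

/-- `t` is the ordinate of a zero of `ζ`. -/
def IsZetaOrdinate (t : ℝ) : Prop :=
  ∃ s : ℂ, riemannZeta s = 0 ∧ s.im = t

open Classical in
/-- The value at `1/2 + it` of the logarithm of `ζ` obtained by continuous variation along
the broken line from `2` through `2 + it` to `1/2 + it`. It exists and is unique if `t ≠ 0` is not
the ordinate of a zero of `ζ` (see `exists_isLogZetaAlong` and `logZetaHalf_eq`);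
the value `0` is used where there is no such logarithm. -/
noncomputable def logZetaHalf (t : ℝ) : ℂ :=
  if h : ∃ l : ℝ → ℂ, IsLogZetaAlong t l then h.choose 2 else 0

open Classical in
/-- The function `S(t)`, for `t > 0`: it is `(1/π) Im log ζ(1/2 + it)` if `t` is not the ordinate
of a zero of `ζ`, and `(1/2) lim_{ε → 0} (S(t + ε) + S(t - ε))` if it is.
The zeros of `ζ` are discrete, so for an ordinate `t` and small `ε ≠ 0` the numbers `t ± ε` are not
ordinates, and the first formula applies to them. -/
noncomputable def zetaS (t : ℝ) : ℝ :=
  if IsZetaOrdinate t then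
    1 / 2 * limUnder (𝓝[≠] (0 : ℝ)) fun ε : ℝ =>
      1 / Real.pi * (logZetaHalf (t + ε)).im + 1 / Real.pi * (logZetaHalf (t - ε)).im
  else 1 / Real.pi * (logZetaHalf t).im

/-- `f = Ω_±(g)` as `t → ∞`, for a function `g` that is positive for all large `t`:
there is `c > 0` such that `f t ≥ c g(t)` for arbitrarily large `t` and
`f t ≤ -c g(t)` for arbitrarily large `t`. -/
def IsOmegaPlusMinus (f g : ℝ → ℝ) : Prop :=
  ∃ c : ℝ, 0 < c ∧ (∃ᶠ t in atTop, c * g t ≤ f t) ∧ (∃ᶠ t in atTop, f t ≤ -(c * g t))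

theorem continuous_zetaPath (t : ℝ) : Continuous (zetaPath t) := by
  unfold zetaPath
  refine Continuous.if_le (by fun_prop) (by fun_prop) continuous_id continuous_const ?_
  intro u hu
  have hu' : u = 1 := hu
  subst hu'
  norm_num

/-- Away from ordinates of zeros the continuous variation of `log ζ` is possible. -/
theorem exists_isLogZetaAlong {t : ℝ} (ht : t ≠ 0) (hz : ¬ IsZetaOrdinate t) :
    ∃ l : ℝ → ℂ, IsLogZetaAlong t l := by
  set p : ℝ → ℝ := fun u => (projIcc (0 : ℝ) 2 (by norm_num) u : ℝ) with hp
  have hpc : Continuous p := continuous_subtype_val.comp continuous_projIcc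
  have hpm : ∀ u, p u ∈ Icc (0 : ℝ) 2 := fun u => (projIcc (0 : ℝ) 2 (by norm_num) u).2
  have hpe : ∀ u ∈ Icc (0 : ℝ) 2, p u = u := fun u hu => by
    simp [hp, projIcc_of_mem _ hu]
  have hne1 : ∀ u, zetaPath t u ≠ 1 := by
    intro u h
    unfold zetaPath at h
    split_ifs at h
    · have := congrArg Complex.re h; norm_num at this
    · have := congrArg Complex.im h; simp at this; exact ht this
  have hne0 : ∀ u, riemannZeta (zetaPath t u) ≠ 0 := by
    intro u h
    by_cases hu : u ≤ 1
    · refine riemannZeta_ne_zero_of_one_lt_re ?_ h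
      simp [zetaPath, hu]
    · exact hz ⟨_, h, by simp [zetaPath, hu]⟩
  have hg : Continuous fun u => riemannZeta (zetaPath t (p u)) := by
    rw [continuous_iff_continuousAt]
    intro u
    exact ContinuousAt.comp (g := riemannZeta) (differentiableAt_riemannZeta (hne1 _)).continuousAt
      ((continuous_zetaPath t).comp hpc).continuousAt
  have h0 : p 0 = 0 := hpe 0 (by norm_num)
  have hstart : Complex.exp ((Real.log (Real.pi ^ 2 / 6) : ℝ) : ℂ)
      = riemannZeta (zetaPath t (p 0)) := by
    have : zetaPath t 0 = 2 := by simp [zetaPath]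
    rw [h0, this, riemannZeta_two, ← Complex.ofReal_exp, Real.exp_log (by positivity)]
    push_cast
    rfl
  obtain ⟨l, ⟨hl0, hl⟩, -⟩ := Complex.isCoveringMapOn_exp.existsUnique_continuousMap_lifts
    ⟨_, hg⟩ (a₀ := (0 : ℝ)) hstart (fun u => hne0 _)
  refine ⟨l, l.continuous.continuousOn, fun u hu => ?_, ?_⟩
  · have := congrFun hl u
    simpa [hpe u hu] using this
  · rw [hl0]; exact Complex.ofReal_im _

/-- The logarithm of `ζ` obtained by continuous variation has a unique end value. -/
theorem logZetaHalf_eq {t : ℝ} {l : ℝ → ℂ} (hl : IsLogZetaAlong t l) :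
    logZetaHalf t = l 2 := by
  have h : ∃ l : ℝ → ℂ, IsLogZetaAlong t l := ⟨l, hl⟩
  unfold logZetaHalf
  rw [dif_pos h]
  set m := h.choose with hm
  have hm' : IsLogZetaAlong t m := h.choose_spec
  have hpos : (2 * Real.pi : ℝ) ≠ 0 := by positivity
  have key : ∀ u ∈ Icc (0 : ℝ) 2, ∃ n : ℤ, m u = l u + n * (2 * Real.pi * Complex.I) :=
    fun u hu => Complex.exp_eq_exp_iff_exists_int.1 ((hm'.exp_eq u hu).trans (hl.exp_eq u hu).symm)
  set d : ℝ → ℝ := fun u => (m u - l u).im / (2 * Real.pi) with hd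
  have hdc : ContinuousOn d (Icc 0 2) :=
    (Complex.continuous_im.comp_continuousOn (hm'.continuousOn.sub hl.continuousOn)).div_const _
  have hdn : ∀ u ∈ Icc (0 : ℝ) 2, ∀ n : ℤ, m u = l u + n * (2 * Real.pi * Complex.I) →
      d u = n := by
    intro u _ n hn
    simp only [hd, hn]
    simp
  have h2 : (2 : ℝ) ∈ Icc (0 : ℝ) 2 := by norm_num
  have h0 : (0 : ℝ) ∈ Icc (0 : ℝ) 2 := by norm_num
  have hd0 : d 0 = 0 := by simp [hd, hm'.im_zero, hl.im_zero]
  obtain ⟨n, hn⟩ := key 2 h2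
  have hd2 : d 2 = n := hdn 2 h2 n hn
  have hconst : d 2 = d 0 := by
    refine isPreconnected_Icc.constant_of_mapsTo
      (T := range ((↑) : ℤ → ℝ))
      ⟨Int.isClosedEmbedding_coe_real.isEmbedding.toHomeomorph.symm.isEmbedding.discreteTopology⟩ hdc ?_ h2 h0
    intro u hu
    obtain ⟨k, hk⟩ := key u hu
    exact ⟨k, (hdn u hu k hk).symm⟩
  have : n = 0 := by
    have : (n : ℝ) = 0 := by rw [← hd2, hconst, hd0]
    exact_mod_cast this
  rw [hn, this]
  simp

/-! Under RH, `log ζ` is holomorphic on `critQuadrant`, and its imaginary part tends to `π S(t)` at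
the critical line (`IsLogZeta.tendsto_im`). Average it along `Re s = 1/2 + η`, around height `t`,
against the nonnegative kernel `K(x) = e^{-x²/2} (1 + sin lx)` with `l = ± log N`. Moving the
contour to `Re s = 2` turns the average into the Dirichlet sum of `Λ(n)/log n · n^{-1/2-η-it} K̂(log
n)`, up to a bounded error (`exists_norm_integral_sub_sum_le`).

The transform of the sine part is concentrated where `log n` is near `log N` and carries a factor
`1/i`, so the imaginary part of the sum sees `cos(t log n)`, with a sign fixed by that of `l`.
Dirichlet's approximation theorem gives `t` with `cos(t log n) ≥ 1/2` at all prime powers `n ≤ RN`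
(`exists_half_le_cos`); with Chebyshev's estimates the sum then has size at least a constant times
`√N / log N`, with the prescribed sign (`exists_lower_bound_im_sum`).

There are `O(N / log N)` such prime powers, so `log t` can be kept of order `N / log N`, and `√(log
t / log log t)` is then of order `√N / log N`. As `K ≥ 0` has bounded mass, `S` cannot stay below a
small multiple of this (respectively above its negative) throughout the window. Letting `η → 0` is
dominated convergence (`IsLogZeta.le_mul_integral_of_zetaS_le`); ordinates of zeros form a null set,
so the value of `S` there plays no role. -/

/-! ### Polynomial growth of `ζ` to the right of the critical line. -/

/-- The integral `∫₁^∞ {x} x^{-s-1} dx`. -/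
noncomputable def fractMellin (s : ℂ) : ℂ :=
  ∫ t in Ioi (1 : ℝ), ((Int.fract t : ℝ) : ℂ) * (t : ℂ) ^ (-(s + 1))

theorem fractMellin_eq_mellin (s : ℂ) :
    fractMellin s = mellin (indicator (Ioi (1 : ℝ)) fun t => ((Int.fract t : ℝ) : ℂ)) (-s) := by
  unfold fractMellin mellin
  rw [← MeasureTheory.integral_indicator measurableSet_Ioi,
    ← MeasureTheory.integral_indicator measurableSet_Ioi]
  congr 1
  ext t
  by_cases ht : (1 : ℝ) < t
  · rw [indicator_of_mem (by exact ht), indicator_of_mem (by exact zero_lt_one.trans ht),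
      indicator_of_mem (by exact ht), smul_eq_mul, mul_comm]
    ring_nf
  · rw [indicator_of_notMem (by exact ht)]
    by_cases h0 : 0 < t
    · rw [indicator_of_mem (by exact h0), indicator_of_notMem (by exact ht)]; simp
    · rw [indicator_of_notMem (by exact h0)]

theorem differentiableAt_fractMellin {s : ℂ} (hs : 0 < s.re) :
    DifferentiableAt ℂ fractMellin s := by
  have h : fractMellin = fun s => mellin (indicator (Ioi (1 : ℝ)) fun t => ((Int.fract t : ℝ) : ℂ)) (-s) :=
    funext fractMellin_eq_mellin
  rw [h]
  have hb : ∀ t : ℝ, ‖indicator (Ioi (1 : ℝ)) (fun t => ((Int.fract t : ℝ) : ℂ)) t‖ ≤ 1 := by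
    intro t
    refine (norm_indicator_le_norm_self _ _).trans ?_
    rw [Complex.norm_real, Real.norm_eq_abs, abs_of_nonneg (Int.fract_nonneg t)]
    exact (Int.fract_lt_one t).le
  refine DifferentiableAt.comp s (g := mellin _) ?_ differentiable_neg.differentiableAt
  refine mellin_differentiableAt_of_isBigO_rpow (a := 0) (b := (-s).re - 1) ?_ ?_ (by simpa) ?_
    (by simp)
  · refine (MeasureTheory.LocallyIntegrable.locallyIntegrableOn ?_ _)
    refine (MeasureTheory.locallyIntegrable_const (1 : ℝ)).mono ?_ ?_
    · refine Measurable.aestronglyMeasurable ?_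
      exact (Complex.measurable_ofReal.comp measurable_fract).indicator measurableSet_Ioi
    · exact Eventually.of_forall fun t => by simpa using hb t
  · refine Asymptotics.IsBigO.of_bound 1 (Eventually.of_forall fun t => ?_)
    simpa using hb t
  · refine Asymptotics.IsBigO.of_bound 1 ?_
    filter_upwards [mem_nhdsWithin_of_mem_nhds (Iio_mem_nhds (show (0 : ℝ) < 1 by norm_num))]
      with t ht
    rw [indicator_of_notMem (by simpa using ht.le)]
    simp only [norm_zero]; positivity

theorem norm_fractMellin_le {s : ℂ} (hs : 0 < s.re) : ‖fractMellin s‖ ≤ 1 / s.re := by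
  unfold fractMellin
  have hint := integrableOn_Ioi_rpow_of_lt (show -s.re - 1 < -1 by linarith) zero_lt_one
  refine (MeasureTheory.norm_integral_le_of_norm_le hint ?_).trans ?_
  · filter_upwards [MeasureTheory.ae_restrict_mem measurableSet_Ioi] with t ht
    have ht0 : (0 : ℝ) < t := zero_lt_one.trans ht
    rw [norm_mul, Complex.norm_real, Real.norm_eq_abs, abs_of_nonneg (Int.fract_nonneg t),
      Complex.norm_cpow_eq_rpow_re_of_pos ht0]
    have : (-(s + 1)).re = -s.re - 1 := by simp; ring
    rw [this]
    exact mul_le_of_le_one_left (by positivity) (Int.fract_lt_one t).le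
  · rw [integral_Ioi_rpow_of_lt (by linarith) zero_lt_one]
    simp

/-- Abel summation of `∑ n^{-s}`, with `⌊t⌋ = t - {t}`: the part from `t` produces the pole, the
part from `{t}` is `fractMellin`. -/
theorem riemannZeta₀_eq_of_one_lt_re {s : ℂ} (hs : 1 < s.re) :
    riemannZeta₀ s = 1 - s * fractMellin s := by
  have hs1 : s ≠ 1 := by rintro rfl; simp at hs
  have hs0 : s ≠ 0 := by rintro rfl; simp at hs; linarith
  have hsub : s - 1 ≠ 0 := sub_ne_zero.2 hs1
  have h1 := LSeries_eq_mul_integral (f := 1) (r := 1) zero_le_one hs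
    (LSeriesSummable_one_iff.2 hs) (by
      refine Asymptotics.IsBigO.of_bound 1 (Eventually.of_forall fun n => ?_)
      simp)
  rw [LSeries_one_eq_riemannZeta hs, riemannZeta_eq_inv_sub_add hs1] at h1
  have hI1 : MeasureTheory.IntegrableOn (fun t : ℝ => (t : ℂ) ^ (-s)) (Ioi 1) :=
    integrableOn_Ioi_cpow_of_lt (by simpa using hs) zero_lt_one
  have hI2 : MeasureTheory.IntegrableOn
      (fun t : ℝ => ((Int.fract t : ℝ) : ℂ) * (t : ℂ) ^ (-(s + 1))) (Ioi 1) := by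
    refine MeasureTheory.Integrable.bdd_mul (c := 1)
      (integrableOn_Ioi_cpow_of_lt (by simp; linarith) zero_lt_one) ?_ ?_
    · exact (Complex.measurable_ofReal.comp measurable_fract).aestronglyMeasurable
    · refine Eventually.of_forall fun t => ?_
      rw [Complex.norm_real, Real.norm_eq_abs, abs_of_nonneg (Int.fract_nonneg t)]
      exact (Int.fract_lt_one t).le
  have h2 : ∫ t in Ioi (1 : ℝ), (∑ k ∈ Finset.Icc 1 ⌊t⌋₊, (1 : ℕ → ℂ) k) * (t : ℂ) ^ (-(s + 1)) =
      (∫ t in Ioi (1 : ℝ), (t : ℂ) ^ (-s)) - fractMellin s := by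
    unfold fractMellin
    rw [← MeasureTheory.integral_sub hI1 hI2]
    refine MeasureTheory.setIntegral_congr_fun measurableSet_Ioi fun t ht => ?_
    have ht0 : (0 : ℝ) < t := zero_lt_one.trans ht
    have hfl : ((⌊t⌋₊ : ℝ) : ℂ) = t - Int.fract t := by
      rw [← Complex.ofReal_sub, Int.self_sub_fract, natCast_floor_eq_intCast_floor ht0.le]
    have hc : (t : ℂ) ^ (-s) = t * (t : ℂ) ^ (-(s + 1)) := by
      have h0 : (t : ℂ) ≠ 0 := by exact_mod_cast ht0.ne'
      rw [show -s = -(s + 1) + 1 by ring, Complex.cpow_add _ _ h0, Complex.cpow_one, mul_comm]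
    simp only [Pi.one_apply, Finset.sum_const, Nat.card_Icc, add_tsub_cancel_right, nsmul_eq_mul,
      mul_one]
    rw [hc, ← sub_mul, ← hfl]
    push_cast; rfl
  rw [h2, integral_Ioi_cpow_of_lt (by simpa using hs) zero_lt_one] at h1
  have h3 : -((1 : ℝ) : ℂ) ^ (-s + 1) / (-s + 1) = (s - 1)⁻¹ := by
    rw [Complex.ofReal_one, Complex.one_cpow, show -s + 1 = -(s - 1) by ring, neg_div_neg_eq,
      one_div]
  rw [h3] at h1
  have : riemannZeta₀ s = (s * (s - 1)⁻¹ - (s - 1)⁻¹) - s * fractMellin s := by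
    linear_combination h1
  rw [this]
  field_simp

theorem riemannZeta₀_eq {s : ℂ} (hs : 0 < s.re) :
    riemannZeta₀ s = 1 - s * fractMellin s := by
  have hopen : IsOpen {z : ℂ | 0 < z.re} := isOpen_lt continuous_const Complex.continuous_re
  have hpre : IsPreconnected {z : ℂ | 0 < z.re} :=
    (convex_halfSpace_re_gt 0).isPreconnected
  have hd : DifferentiableOn ℂ (fun s => 1 - s * fractMellin s) {z : ℂ | 0 < z.re} := fun z hz =>
    ((differentiableAt_const _).sub
      (differentiableAt_id.mul (differentiableAt_fractMellin hz))).differentiableWithinAt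
  have h := (differentiable_riemannZeta₀.differentiableOn.analyticOnNhd hopen).eqOn_of_preconnected_of_eventuallyEq
    (hd.analyticOnNhd hopen) hpre (z₀ := 2) (by simp) (by
      filter_upwards [(isOpen_lt continuous_const Complex.continuous_re).mem_nhds
        (show (1 : ℝ) < (2 : ℂ).re by simp)] with z hz
      exact riemannZeta₀_eq_of_one_lt_re hz)
  exact h hs

theorem norm_riemannZeta_le {s : ℂ} (hs : 1 / 2 ≤ s.re) (ht : 1 / 2 ≤ s.im) :
    ‖riemannZeta s‖ ≤ 3 + 2 * ‖s‖ := by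
  have hs1 : s ≠ 1 := by rintro rfl; norm_num at ht
  rw [riemannZeta_eq_inv_sub_add hs1, riemannZeta₀_eq (by linarith)]
  have h1 : ‖(s - 1)⁻¹‖ ≤ 2 := by
    rw [norm_inv]
    have : (1 / 2 : ℝ) ≤ ‖s - 1‖ := by
      have := Complex.abs_im_le_norm (s - 1)
      simp only [Complex.sub_im, Complex.one_im, sub_zero] at this
      exact ht.trans ((le_abs_self _).trans this)
    exact inv_le_of_inv_le₀ (by norm_num) (by simpa using this)
  have h2 : ‖fractMellin s‖ ≤ 2 := (norm_fractMellin_le (by linarith)).trans (by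
    rw [div_le_iff₀ (by linarith)]; linarith)
  calc ‖(s - 1)⁻¹ + (1 - s * fractMellin s)‖ ≤ ‖(s - 1)⁻¹‖ + (‖(1 : ℂ)‖ + ‖s * fractMellin s‖) :=
        (norm_add_le _ _).trans (by gcongr; exact norm_sub_le _ _)
    _ ≤ 2 + (1 + ‖s‖ * 2) := by
        rw [norm_mul, norm_one]; gcongr
    _ = 3 + 2 * ‖s‖ := by ring

/-! ### The Dirichlet series of `log ζ` for `Re s > 1`. -/

open scoped ArithmeticFunction.vonMangoldt in
/-- The coefficients `Λ(n) / log n` of the Dirichlet series of `log ζ`. -/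
noncomputable def logZetaCoeff (n : ℕ) : ℝ := Λ n / Real.log n

theorem logZetaCoeff_nonneg (n : ℕ) : 0 ≤ logZetaCoeff n :=
  div_nonneg ArithmeticFunction.vonMangoldt_nonneg (Real.log_natCast_nonneg n)

theorem logZetaCoeff_le_one (n : ℕ) : logZetaCoeff n ≤ 1 :=
  div_le_one_of_le₀ ArithmeticFunction.vonMangoldt_le_log (Real.log_natCast_nonneg n)

theorem logZetaCoeff_zero : logZetaCoeff 0 = 0 := by simp [logZetaCoeff]

theorem logZetaCoeff_one : logZetaCoeff 1 = 0 := by simp [logZetaCoeff]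

/-- The Dirichlet series of `log ζ`. -/
noncomputable def logZetaSeries (s : ℂ) : ℂ := LSeries (fun n => (logZetaCoeff n : ℂ)) s

theorem abscissaOfAbsConv_logZetaCoeff :
    LSeries.abscissaOfAbsConv (fun n => (logZetaCoeff n : ℂ)) ≤ 1 := by
  refine LSeries.abscissaOfAbsConv_le_one_of_isBigO_one ?_
  refine Asymptotics.IsBigO.of_bound 1 (Eventually.of_forall fun n => ?_)
  rw [Complex.norm_real, Real.norm_eq_abs, abs_of_nonneg (logZetaCoeff_nonneg n)]
  simpa using logZetaCoeff_le_one n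

theorem abscissaOfAbsConv_logZetaCoeff_lt {s : ℂ} (hs : 1 < s.re) :
    LSeries.abscissaOfAbsConv (fun n => (logZetaCoeff n : ℂ)) < s.re :=
  abscissaOfAbsConv_logZetaCoeff.trans_lt (by exact_mod_cast hs)

theorem hasDerivAt_logZetaSeries {s : ℂ} (hs : 1 < s.re) :
    HasDerivAt logZetaSeries (deriv riemannZeta s / riemannZeta s) s := by
  have h := LSeries_hasDerivAt (abscissaOfAbsConv_logZetaCoeff_lt hs)
  have h2 : LSeries (LSeries.logMul fun n => (logZetaCoeff n : ℂ)) s =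
      - (deriv riemannZeta s / riemannZeta s) := by
    rw [← neg_div, ← ArithmeticFunction.LSeries_vonMangoldt_eq_deriv_riemannZeta_div hs]
    refine LSeries_congr (fun {n} hn => ?_) s
    rcases eq_or_ne n 1 with rfl | h1
    · simp [LSeries.logMul]
    · have : Real.log n ≠ 0 := by
        have : (1 : ℝ) < n := by
          have : 1 < n := by omega
          exact_mod_cast this
        exact (Real.log_pos this).ne'
      simp only [LSeries.logMul, logZetaCoeff, ← Complex.natCast_log]
      rw [← Complex.ofReal_mul, mul_div_cancel₀ _ this]
  rw [h2, neg_neg] at h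
  exact h

/-- The quotient of the two sides has zero derivative on the half-plane, and both sides tend to `1`
as `s → +∞` along the reals. -/
theorem exp_logZetaSeries {s : ℂ} (hs : 1 < s.re) :
    Complex.exp (logZetaSeries s) = riemannZeta s := by
  have hopen : IsOpen {z : ℂ | 1 < z.re} := isOpen_lt continuous_const Complex.continuous_re
  have hpre : IsPreconnected {z : ℂ | 1 < z.re} := (convex_halfSpace_re_gt 1).isPreconnected
  have hne1 : ∀ z : ℂ, 1 < z.re → z ≠ 1 := by rintro z hz rfl; simp at hz
  have hd : ∀ z ∈ {z : ℂ | 1 < z.re},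
      HasDerivAt (fun z => Complex.exp (logZetaSeries z) / riemannZeta z) 0 z := by
    intro z hz
    have hz0 := riemannZeta_ne_zero_of_one_lt_re hz
    have h := (hasDerivAt_logZetaSeries hz).cexp.div
      (differentiableAt_riemannZeta (hne1 z hz)).hasDerivAt hz0
    rwa [mul_assoc, div_mul_cancel₀ _ hz0, sub_self, zero_div] at h
  have hconst : ∀ z : ℂ, 1 < z.re → Complex.exp (logZetaSeries z) / riemannZeta z =
      Complex.exp (logZetaSeries s) / riemannZeta s := by
    intro z hz
    exact hopen.is_const_of_deriv_eq_zero hpre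
      (fun w hw => (hd w hw).differentiableAt.differentiableWithinAt)
      (fun w hw => (hd w hw).deriv) hz hs
  have h1 : Tendsto (fun x : ℝ => Complex.exp (logZetaSeries x)) atTop (𝓝 1) := by
    have := LSeries.tendsto_atTop (f := fun n => (logZetaCoeff n : ℂ))
      (abscissaOfAbsConv_logZetaCoeff.trans_lt (by decide))
    rw [logZetaCoeff_one] at this
    have h0 := (Complex.continuous_exp.tendsto _).comp this
    rwa [Complex.ofReal_zero, Complex.exp_zero] at h0
  have h2 : Tendsto (fun x : ℝ => riemannZeta x) atTop (𝓝 1) := by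
    have := LSeries.tendsto_atTop (f := 1)
      (by rw [LSeries.abscissaOfAbsConv_one]; decide)
    refine this.congr' ?_
    filter_upwards [eventually_gt_atTop 1] with x hx
    exact LSeries_one_eq_riemannZeta (by simpa using hx)
  have h3 := h1.div h2 one_ne_zero
  have h4 : Tendsto (fun x : ℝ => Complex.exp (logZetaSeries x) / riemannZeta x) atTop
      (𝓝 (Complex.exp (logZetaSeries s) / riemannZeta s)) := by
    refine tendsto_const_nhds.congr' ?_
    filter_upwards [eventually_gt_atTop 1] with x hx
    exact (hconst x (by simpa using hx)).symm
  have := tendsto_nhds_unique h4 h3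
  rw [div_one] at this
  exact eq_of_div_eq_one this

/-! ### The branch of `log ζ` under the Riemann Hypothesis. -/

theorem differentiableAt_of_exp_eq {f g : ℂ → ℂ} {s : ℂ} (hf : ContinuousAt f s)
    (hg : DifferentiableAt ℂ g s) (h : ∀ᶠ z in 𝓝 s, Complex.exp (f z) = g z) :
    DifferentiableAt ℂ f s := by
  have hgs : g s ≠ 0 := by rw [← h.self_of_nhds]; exact Complex.exp_ne_zero _
  -- Continuity keeps `f z - f s` within distance `1 < π` of `0`, where the principal logarithm
  -- inverts `exp`.
  have h1 : ∀ᶠ z in 𝓝 s, f z = f s + Complex.log (g z / g s) := by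
    have hc : Tendsto (fun z => f z - f s) (𝓝 s) (𝓝 0) := by
      simpa using hf.tendsto.sub_const (f s)
    filter_upwards [h, hc (Metric.ball_mem_nhds 0 one_pos)] with z hz hb
    have hb' : ‖f z - f s‖ < 1 := by simpa using hb
    have him := (Complex.abs_im_le_norm (f z - f s)).trans_lt hb'
    have hpi := Real.pi_gt_three
    rw [abs_lt] at him
    rw [← hz, ← h.self_of_nhds, ← Complex.exp_sub, Complex.log_exp (by linarith) (by linarith)]
    ring
  refine DifferentiableAt.congr_of_eventuallyEq ?_ h1
  refine (differentiableAt_const _).add ((hg.div_const _).clog ?_)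
  rw [div_self hgs]
  exact Complex.one_mem_slitPlane

/-- The quadrant on which, under the Riemann Hypothesis, `log ζ` is defined. -/
def critQuadrant : Set ℂ := {s | 1 / 2 < s.re ∧ 0 < s.im}

theorem isOpen_critQuadrant : IsOpen critQuadrant :=
  (isOpen_lt continuous_const Complex.continuous_re).inter
    (isOpen_lt continuous_const Complex.continuous_im)

theorem convex_critQuadrant : Convex ℝ critQuadrant :=
  (convex_halfSpace_re_gt _).inter (convex_halfSpace_im_gt _)

theorem riemannZeta_ne_zero_of_mem_critQuadrant (hRH : RiemannHypothesis) {s : ℂ}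
    (hs : s ∈ critQuadrant) : riemannZeta s ≠ 0 := by
  intro h
  have hs1 : s ≠ 1 := by rintro rfl; simpa using hs.2
  have := hRH s h (by
    rintro ⟨n, rfl⟩
    have := hs.2
    simp at this) hs1
  exact absurd hs.1 (by rw [this]; exact lt_irrefl _)

/-- `f` is the branch of `log ζ` on `critQuadrant` given by the Dirichlet series for `Re s > 1`. -/
structure IsLogZeta (f : ℂ → ℂ) : Prop where
  differentiableOn : DifferentiableOn ℂ f critQuadrant
  exp_eq : ∀ s ∈ critQuadrant, Complex.exp (f s) = riemannZeta s
  eq_series : ∀ s ∈ critQuadrant, 1 < s.re → f s = logZetaSeries s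

theorem exists_isLogZeta (hRH : RiemannHypothesis) : ∃ f : ℂ → ℂ, IsLogZeta f := by
  have hz1 : ∀ s ∈ critQuadrant, s ≠ 1 := by rintro s hs rfl; simpa using hs.2
  have hzd : ∀ s ∈ critQuadrant, DifferentiableAt ℂ riemannZeta s := fun s hs =>
    differentiableAt_riemannZeta (hz1 s hs)
  have hne : critQuadrant.Nonempty := ⟨2 + Complex.I, by constructor <;> norm_num⟩
  have hsc : IsSimplyConnected critQuadrant := by
    have := convex_critQuadrant.contractibleSpace hne
    have h : SimplyConnectedSpace critQuadrant := inferInstance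
    exact h
  obtain ⟨g, hgc, hge⟩ := Complex.exists_continuousOn_eqOn_exp_comp hsc isOpen_critQuadrant
    (g := riemannZeta) (fun s hs => (hzd s hs).continuousAt.continuousWithinAt) (by
      rintro ⟨s, hs, h⟩
      exact riemannZeta_ne_zero_of_mem_critQuadrant hRH hs h)
  have hgd : ∀ s ∈ critQuadrant, DifferentiableAt ℂ g s := fun s hs =>
    differentiableAt_of_exp_eq (hgc.continuousAt (isOpen_critQuadrant.mem_nhds hs)) (hzd s hs)
      (by filter_upwards [isOpen_critQuadrant.mem_nhds hs] with z hz using hge hz)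
  set T : Set ℂ := critQuadrant ∩ {s | 1 < s.re} with hT
  have hTo : IsOpen T := isOpen_critQuadrant.inter (isOpen_lt continuous_const Complex.continuous_re)
  have hTp : IsPreconnected T :=
    (convex_critQuadrant.inter (convex_halfSpace_re_gt 1)).isPreconnected
  have hderiv : ∀ s ∈ T, HasDerivAt (fun z => g z - logZetaSeries z) 0 s := by
    intro s hs
    have h1 := (hgd s hs.1).hasDerivAt
    have h2 : deriv g s = deriv riemannZeta s / riemannZeta s := by
      have h3 := h1.cexp
      have h4 : HasDerivAt riemannZeta (Complex.exp (g s) * deriv g s) s :=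
        h3.congr_of_eventuallyEq (by
          filter_upwards [isOpen_critQuadrant.mem_nhds hs.1] with z hz using (hge hz).symm)
      rw [h4.deriv, show riemannZeta s = Complex.exp (g s) from (hge hs.1).symm]
      field_simp
    rw [h2] at h1
    have h5 := h1.sub (hasDerivAt_logZetaSeries hs.2)
    rwa [sub_self] at h5
  have h2T : (2 + Complex.I) ∈ T := ⟨by constructor <;> norm_num, by simp⟩
  set k : ℂ := g (2 + Complex.I) - logZetaSeries (2 + Complex.I) with hk
  have hkT : ∀ s ∈ T, g s - logZetaSeries s = k := fun s hs =>
    hTo.is_const_of_deriv_eq_zero hTp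
      (fun w hw => (hderiv w hw).differentiableAt.differentiableWithinAt)
      (fun w hw => (hderiv w hw).deriv) hs h2T
  -- The branch supplied by simple connectedness differs from the series by a period of `exp`, so
  -- subtracting `k` repairs it.
  have hke : Complex.exp k = 1 := by
    rw [hk, Complex.exp_sub, exp_logZetaSeries h2T.2,
      show Complex.exp (g (2 + Complex.I)) = _ from hge h2T.1]
    exact div_self (riemannZeta_ne_zero_of_mem_critQuadrant hRH h2T.1)
  refine ⟨fun s => g s - k, fun s hs => ((hgd s hs).sub_const k).differentiableWithinAt,
    fun s hs => ?_, fun s hs h1 => ?_⟩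
  · rw [Complex.exp_sub, hke, div_one]; exact hge hs
  · rw [← hkT s ⟨hs, h1⟩]; ring

/-- The difference of two logarithms is continuous with values in the discrete set `2πiℤ`, hence
constant on a preconnected set. -/
theorem IsPreconnected.sub_eq_sub_of_exp_eq {X : Type*} [TopologicalSpace X] {S : Set X}
    (hS : IsPreconnected S) {l m : X → ℂ} (hl : ContinuousOn l S) (hm : ContinuousOn m S)
    (h : ∀ x ∈ S, Complex.exp (l x) = Complex.exp (m x)) {a b : X} (ha : a ∈ S) (hb : b ∈ S) :
    l a - m a = l b - m b := by
  have key : ∀ u ∈ S, ∃ n : ℤ, l u - m u = n * (2 * Real.pi * Complex.I) := fun u hu => by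
    obtain ⟨n, hn⟩ := Complex.exp_eq_exp_iff_exists_int.1 (h u hu)
    exact ⟨n, by rw [hn]; ring⟩
  have hpi : (2 * Real.pi * Complex.I : ℂ) ≠ 0 := Complex.two_pi_I_ne_zero
  have hpi' : (2 * Real.pi : ℝ) ≠ 0 := by positivity
  set d : X → ℝ := fun u => (l u - m u).im / (2 * Real.pi) with hd
  have hdc : ContinuousOn d S :=
    (Complex.continuous_im.comp_continuousOn (hl.sub hm)).div_const _
  have hdn : ∀ u, ∀ n : ℤ, l u - m u = n * (2 * Real.pi * Complex.I) → d u = n := by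
    intro u n hn
    simp only [hd, hn]
    simp
  have hconst : d a = d b := by
    refine hS.constant_of_mapsTo (T := range ((↑) : ℤ → ℝ))
      ⟨Int.isClosedEmbedding_coe_real.isEmbedding.toHomeomorph.symm.isEmbedding.discreteTopology⟩
      hdc ?_ ha hb
    intro u hu
    obtain ⟨k, hk⟩ := key u hu
    exact ⟨k, (hdn u k hk).symm⟩
  obtain ⟨n, hn⟩ := key a ha
  obtain ⟨k, hk⟩ := key b hb
  rw [hdn a n hn, hdn b k hk] at hconst
  rw [hn, hk, show n = k by exact_mod_cast hconst]

/-! ### Boundary behaviour of `log ζ` at the critical line. -/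

theorem logZetaSeries_two_im : (logZetaSeries 2).im = 0 := by
  have : logZetaSeries 2 = ((∑' n : ℕ, logZetaCoeff n / (n : ℝ) ^ 2 : ℝ) : ℂ) := by
    rw [Complex.ofReal_tsum]
    refine tsum_congr fun n => ?_
    rcases eq_or_ne n 0 with rfl | hn
    · simp
    · rw [LSeries.term_of_ne_zero hn]
      push_cast
      norm_cast
  rw [this, Complex.ofReal_im]

/-- Continuous variation is compared with the Dirichlet series on the vertical segment and with `f`
on the horizontal one. The end point lies outside `critQuadrant`, so it is reached only as a limit.
-/
theorem IsLogZeta.tendsto_im {f : ℂ → ℂ} (hf : IsLogZeta f) {t : ℝ} (ht : 0 < t)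
    (hz : ¬ IsZetaOrdinate t) :
    Tendsto (fun σ : ℝ => (f (σ + t * Complex.I)).im) (𝓝[>] (1 / 2)) (𝓝 (Real.pi * zetaS t)) := by
  obtain ⟨l, hl⟩ := exists_isLogZetaAlong ht.ne' hz
  have hS : Real.pi * zetaS t = (l 2).im := by
    unfold zetaS
    rw [if_neg hz, logZetaHalf_eq hl]
    field_simp
  rw [hS]
  have hp1 : ∀ u : ℝ, u ≤ 1 → 1 < (zetaPath t u).re := by
    intro u hu
    simp [zetaPath, hu]
  have hp2 : ∀ u ∈ Ico (1 : ℝ) 2, zetaPath t u ∈ critQuadrant := by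
    intro u hu
    unfold zetaPath
    split_ifs with h
    · have : u = 1 := le_antisymm h hu.1
      subst this
      constructor
      · norm_num
      · simpa using ht
    · constructor
      · have := hu.2
        simp
        linarith
      · simpa using ht
  have h01 : (l 1).im = (logZetaSeries (zetaPath t 1)).im := by
    have hc : ContinuousOn (fun u => logZetaSeries (zetaPath t u)) (Icc 0 1) := fun u hu =>
      (ContinuousAt.comp (g := logZetaSeries) (hasDerivAt_logZetaSeries (hp1 u hu.2)).continuousAt
        (continuous_zetaPath t).continuousAt).continuousWithinAt
    have h := isPreconnected_Icc.sub_eq_sub_of_exp_eq (a := 1) (b := 0)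
      (hl.continuousOn.mono (Icc_subset_Icc_right one_le_two)) hc
      (fun u hu => by
        rw [hl.exp_eq u ⟨hu.1, hu.2.trans one_le_two⟩, exp_logZetaSeries (hp1 u hu.2)])
      (by simp) (by simp)
    have h0 : zetaPath t 0 = 2 := by simp [zetaPath]
    rw [h0] at h
    have := congrArg Complex.im h
    simp only [Complex.sub_im, hl.im_zero, logZetaSeries_two_im] at this
    linarith
  have h12 : ∀ u ∈ Ico (1 : ℝ) 2, (f (zetaPath t u)).im = (l u).im := by
    intro u hu
    have hc : ContinuousOn (fun u => f (zetaPath t u)) (Ico 1 2) := fun v hv =>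
      (ContinuousAt.comp (g := f)
        (hf.differentiableOn.differentiableAt (isOpen_critQuadrant.mem_nhds (hp2 v hv))).continuousAt
        (continuous_zetaPath t).continuousAt).continuousWithinAt
    have h := isPreconnected_Ico.sub_eq_sub_of_exp_eq (a := u) (b := 1)
      (hl.continuousOn.mono (Ico_subset_Icc_self.trans (Icc_subset_Icc_left zero_le_one))) hc
      (fun v hv => by
        rw [hl.exp_eq v ⟨zero_le_one.trans hv.1, hv.2.le⟩, hf.exp_eq _ (hp2 v hv)])
      hu (by simp)
    rw [hf.eq_series (zetaPath t 1) (hp2 1 (by simp)) (hp1 1 le_rfl)] at h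
    have := congrArg Complex.im h
    simp only [Complex.sub_im, h01] at this
    linarith
  have hlim : Tendsto (fun u => (l u).im) (𝓝[<] 2) (𝓝 (l 2).im) := by
    have h := (hl.continuousOn 2 (by simp)).mono_left
      (nhdsWithin_mono 2 (show Ico (0 : ℝ) 2 ⊆ Icc 0 2 from Ico_subset_Icc_self))
    rw [nhdsWithin_Ico_eq_nhdsLT (by norm_num)] at h
    exact (Complex.continuous_im.tendsto _).comp h
  -- This is the parameter `u` at which the horizontal segment of `zetaPath` has real part `σ`.
  have hsub : Tendsto (fun σ : ℝ => 2 - 2 / 3 * (σ - 1 / 2)) (𝓝[>] (1 / 2)) (𝓝[<] 2) := by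
    refine tendsto_nhdsWithin_iff.2 ⟨?_, ?_⟩
    · refine Tendsto.mono_left ?_ nhdsWithin_le_nhds
      have : Continuous fun σ : ℝ => 2 - 2 / 3 * (σ - 1 / 2) := by fun_prop
      simpa using this.tendsto (1 / 2)
    · filter_upwards [self_mem_nhdsWithin] with σ hσ
      have : 1 / 2 < σ := hσ
      simp only [mem_Iio]
      linarith
  refine (hlim.comp hsub).congr' ?_
  filter_upwards [Ioo_mem_nhdsGT (show (1 / 2 : ℝ) < 1 by norm_num)] with σ hσ
  simp only [Function.comp]
  rw [← h12 _ ⟨by linarith [hσ.2], by linarith [hσ.1]⟩]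
  congr 2
  unfold zetaPath
  rw [if_neg (by linarith [hσ.2])]
  congr 2
  ring

/-- Near a point `ρ` of the line, `ζ(s) = (s - ρ)^n g(s)` with `g(ρ) ≠ 0`, so `f` is `n log(s - ρ) +
log(g(s)/g(ρ))` up to a constant. Its real part may blow up at a zero, but arguments stay bounded.
-/
theorem IsLogZeta.exists_im_bound_near {f : ℂ → ℂ} (hf : IsLogZeta f) {t : ℝ} (ht : 0 < t) :
    ∃ δ > 0, ∃ C, ∀ s ∈ Metric.ball ((1 / 2 : ℝ) + t * Complex.I) δ ∩ critQuadrant,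
      |(f s).im| ≤ C := by
  set ρ : ℂ := (1 / 2 : ℝ) + t * Complex.I with hρ
  have hρ1 : ρ ≠ 1 := by
    intro h
    have := congrArg Complex.im h
    simp [hρ] at this
    exact ht.ne' this
  have han : AnalyticAt ℂ riemannZeta ρ := analyticOn_riemannZeta ρ hρ1
  have hclos : ρ ∈ closure critQuadrant := by
    have : Tendsto (fun x : ℝ => ρ + x) (𝓝[>] 0) (𝓝 ρ) := by
      have h : Continuous fun x : ℝ => ρ + x := by fun_prop
      simpa using (h.tendsto 0).mono_left nhdsWithin_le_nhds
    refine mem_closure_of_tendsto this ?_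
    filter_upwards [self_mem_nhdsWithin] with x hx
    have hx' : 0 < x := hx
    constructor
    · simp [hρ]; linarith
    · simpa [hρ] using ht
  have hnz : ¬ ∀ᶠ z in 𝓝 ρ, riemannZeta z = 0 := by
    intro h
    obtain ⟨z, hz1, hz2⟩ := mem_closure_iff_nhds.1 hclos _ h
    have h3 := hf.exp_eq z hz2
    rw [show riemannZeta z = 0 from hz1] at h3
    exact Complex.exp_ne_zero _ h3
  obtain ⟨n, g, hg, hg0, hgz⟩ := han.exists_eventuallyEq_pow_smul_nonzero_iff.2 hnz
  have hq : ∀ᶠ z in 𝓝 ρ, ‖g z / g ρ - 1‖ < 1 := by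
    have h1 : Tendsto (fun z => g z / g ρ - 1) (𝓝 ρ) (𝓝 0) := by
      have := (hg.continuousAt.tendsto.div_const (g ρ)).sub_const 1
      rwa [div_self hg0, sub_self] at this
    filter_upwards [h1 (Metric.ball_mem_nhds 0 one_pos)] with z hz
    simpa using hz
  have hgc : ∀ᶠ z in 𝓝 ρ, ContinuousAt g z := hg.eventually_continuousAt
  obtain ⟨δ, hδ, hball⟩ := Metric.eventually_nhds_iff_ball.1 (hgz.and (hq.and hgc))
  set H := Metric.ball ρ δ ∩ critQuadrant with hH
  have hHp : IsPreconnected H := ((convex_ball ρ δ).inter convex_critQuadrant).isPreconnected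
  have hslit : ∀ s ∈ H, s - ρ ∈ Complex.slitPlane := by
    intro s hs
    left
    have := hs.2.1
    simp [hρ]
    linarith
  have hslit' : ∀ s ∈ H, g s / g ρ ∈ Complex.slitPlane := by
    intro s hs
    left
    have h1 := (hball s hs.1).2.1
    have h2 := (Complex.abs_re_le_norm (g s / g ρ - 1)).trans_lt h1
    rw [abs_lt] at h2
    simp only [Complex.sub_re, Complex.one_re] at h2
    linarith
  set m : ℂ → ℂ := fun s => n * Complex.log (s - ρ) + Complex.log (g s / g ρ) with hm
  have hmc : ContinuousOn m H := by
    intro s hs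
    refine ContinuousAt.continuousWithinAt ?_
    exact (continuousAt_const.mul ((continuousAt_id.sub continuousAt_const).clog (hslit s hs))).add
      (((hball s hs.1).2.2.div_const _).clog (hslit' s hs))
  have hme : ∀ s ∈ H, Complex.exp (f s) = Complex.exp (m s + Complex.log (g ρ)) := by
    intro s hs
    rw [hf.exp_eq s hs.2, (hball s hs.1).1, Complex.exp_add, Complex.exp_log hg0, hm]
    simp only
    rw [Complex.exp_add, Complex.exp_log (Complex.slitPlane_ne_zero (hslit' s hs)),
      Complex.exp_nat_mul, Complex.exp_log (Complex.slitPlane_ne_zero (hslit s hs)), smul_eq_mul,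
      mul_assoc, div_mul_cancel₀ _ hg0]
  have hmb : ∀ s, |(m s).im| ≤ n * Real.pi + Real.pi := by
    intro s
    have h1 : (m s).im = n * (Complex.log (s - ρ)).im + (Complex.log (g s / g ρ)).im := by
      simp [hm]
    rw [h1]
    refine (abs_add_le _ _).trans ?_
    rw [abs_mul, Nat.abs_cast, Complex.log_im, Complex.log_im]
    gcongr
    · exact Complex.abs_arg_le_pi _
    · exact Complex.abs_arg_le_pi _
  rcases H.eq_empty_or_nonempty with hem | ⟨s₀, hs₀⟩
  · exact ⟨δ, hδ, 0, fun s hs => absurd hs (by rw [← hH, hem]; exact notMem_empty s)⟩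
  refine ⟨δ, hδ, n * Real.pi + Real.pi + |(f s₀ - m s₀).im|, fun s hs => ?_⟩
  have h : f s - (m s + Complex.log (g ρ)) = f s₀ - (m s₀ + Complex.log (g ρ)) :=
    hHp.sub_eq_sub_of_exp_eq (hf.differentiableOn.continuousOn.mono inter_subset_right)
    (hmc.add continuousOn_const) hme hs hs₀
  have h2 : f s = m s + (f s₀ - m s₀) := by
    linear_combination h
  rw [h2, Complex.add_im]
  exact (abs_add_le _ _).trans (by gcongr; exact hmb s)

/-- Compactness makes the local bounds uniform; this is the majorant for letting `η → 0`. -/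
theorem IsLogZeta.exists_im_bound {f : ℂ → ℂ} (hf : IsLogZeta f) {A B : ℝ} (hA : 0 < A) :
    ∃ δ > 0, ∃ C, ∀ η ∈ Ioo 0 δ, ∀ t ∈ Icc A B,
      |(f ((1 / 2 + η : ℝ) + t * Complex.I)).im| ≤ C := by
  refine (isCompact_Icc (a := A) (b := B)).induction_on (p := fun S => ∃ δ > 0, ∃ C, ∀ η ∈ Ioo (0 : ℝ) δ, ∀ t ∈ S,
    |(f ((1 / 2 + η : ℝ) + t * Complex.I)).im| ≤ C) ?_ ?_ ?_ ?_
  · exact ⟨1, one_pos, 0, by simp⟩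
  · rintro S T hST ⟨δ, hδ, C, h⟩
    exact ⟨δ, hδ, C, fun η hη t ht => h η hη t (hST ht)⟩
  · rintro S T ⟨δ, hδ, C, h⟩ ⟨δ', hδ', C', h'⟩
    refine ⟨min δ δ', lt_min hδ hδ', max C C', fun η hη t ht => ?_⟩
    rcases ht with ht | ht
    · exact (h η ⟨hη.1, hη.2.trans_le (min_le_left _ _)⟩ t ht).trans (le_max_left _ _)
    · exact (h' η ⟨hη.1, hη.2.trans_le (min_le_right _ _)⟩ t ht).trans (le_max_right _ _)
  · intro t ht
    have ht0 : 0 < t := hA.trans_le ht.1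
    obtain ⟨δ, hδ, C, h⟩ := hf.exists_im_bound_near ht0
    refine ⟨Metric.ball t (δ / 2) ∩ Ioi 0,
      mem_nhdsWithin_of_mem_nhds (inter_mem (Metric.ball_mem_nhds t (half_pos hδ)) (Ioi_mem_nhds ht0)),
      δ / 2, half_pos hδ, C, fun η hη t' ht' => h _ ⟨?_, ?_, ?_⟩⟩
    · rw [Metric.mem_ball, dist_eq_norm]
      have h1 : ((1 / 2 + η : ℝ) : ℂ) + t' * Complex.I - ((1 / 2 : ℝ) + t * Complex.I) =
          (η : ℂ) + ((t' - t : ℝ) : ℂ) * Complex.I := by push_cast; ring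
      rw [h1]
      refine (norm_add_le _ _).trans_lt ?_
      rw [norm_mul, Complex.norm_I, mul_one, Complex.norm_real, Complex.norm_real,
        Real.norm_eq_abs, abs_of_pos hη.1]
      have := ht'.1
      rw [Metric.mem_ball, Real.dist_eq] at this
      rw [Real.norm_eq_abs]
      linarith [hη.2]
    · simp [hη.1]
    · simpa using ht'.2

/-! ### Size of `log ζ` between the critical line and `Re s = 2`. -/

/-- The value of the Dirichlet series of `log ζ` at `2`. -/
noncomputable def logZetaTwo : ℝ := ∑' n, ‖LSeries.term (fun n => (logZetaCoeff n : ℂ)) 2 n‖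

theorem logZetaTwo_nonneg : 0 ≤ logZetaTwo := tsum_nonneg fun _ => norm_nonneg _

theorem summable_norm_logZeta_term :
    Summable fun n => ‖LSeries.term (fun n => (logZetaCoeff n : ℂ)) 2 n‖ :=
  (LSeriesSummable_of_abscissaOfAbsConv_lt_re
    (abscissaOfAbsConv_logZetaCoeff_lt (by simp))).norm

theorem norm_logZeta_term_eq {s : ℂ} (hs : s.re = 2) (n : ℕ) :
    ‖LSeries.term (fun n => (logZetaCoeff n : ℂ)) s n‖ =
      ‖LSeries.term (fun n => (logZetaCoeff n : ℂ)) 2 n‖ := by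
  rw [LSeries.norm_term_eq, LSeries.norm_term_eq, hs]; simp

theorem norm_logZetaSeries_le {s : ℂ} (hs : s.re = 2) : ‖logZetaSeries s‖ ≤ logZetaTwo := by
  unfold logZetaSeries LSeries logZetaTwo
  have h := summable_norm_logZeta_term
  simp_rw [← norm_logZeta_term_eq hs] at h ⊢
  exact norm_tsum_le_tsum_norm h

/-- Borel–Carathéodory on the disc about `2 + it` of radius `3/2`, which touches the critical line.
The loss `1/(Re s - 1/2)` is later cancelled by a zero of the kernel, and the linear growth in `t`
by its Gaussian decay. -/
theorem IsLogZeta.norm_le {f : ℂ → ℂ} (hf : IsLogZeta f) {s : ℂ} (h1 : 1 / 2 < s.re)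
    (h2 : s.re ≤ 2) (ht : 2 ≤ s.im) :
    ‖f s‖ ≤ (21 + 3 * logZetaTwo) * s.im / (s.re - 1 / 2) := by
  set t := s.im with htd
  set c : ℂ := 2 + t * Complex.I with hc
  have hmem : ∀ z ∈ Metric.ball (0 : ℂ) (3 / 2), c + z ∈ critQuadrant ∧ 1 / 2 ≤ (c + z).im := by
    intro z hz
    have hz' : ‖z‖ < 3 / 2 := by simpa using hz
    have hre := (Complex.abs_re_le_norm z).trans_lt hz'
    have him := (Complex.abs_im_le_norm z).trans_lt hz'
    rw [abs_lt] at hre him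
    have e1 : (c + z).re = 2 + z.re := by simp [hc]
    have e2 : (c + z).im = t + z.im := by simp [hc]
    refine ⟨⟨?_, ?_⟩, ?_⟩
    · rw [e1]; linarith
    · rw [e2]; linarith
    · rw [e2]; linarith
  have hnc : ‖c‖ ≤ 2 + t := by
    refine (norm_add_le _ _).trans ?_
    rw [norm_mul, Complex.norm_I, mul_one, Complex.norm_real, Real.norm_eq_abs,
      abs_of_nonneg (by linarith)]
    simp
  -- The real part is `log |ζ|`; `log x ≤ x - 1` and the linear bound for `ζ` give at most `9 + 2t`,
  -- and `t ≥ 2`.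
  have hM : ∀ z ∈ Metric.ball (0 : ℂ) (3 / 2), (f (c + z)).re ≤ 7 * t := by
    intro z hz
    have hz' : ‖z‖ < 3 / 2 := by simpa using hz
    have h3 : Real.exp (f (c + z)).re ≤ 3 + 2 * ‖c + z‖ := by
      rw [← Complex.norm_exp, hf.exp_eq _ (hmem z hz).1]
      exact norm_riemannZeta_le (hmem z hz).1.1.le (hmem z hz).2
    have h4 := Real.add_one_le_exp (f (c + z)).re
    have h5 := norm_add_le c z
    linarith
  have hd : DifferentiableOn ℂ (fun z => f (c + z)) (Metric.ball 0 (3 / 2)) := fun z hz =>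
    (DifferentiableAt.comp z (hf.differentiableOn.differentiableAt
      (isOpen_critQuadrant.mem_nhds (hmem z hz).1))
      ((differentiableAt_const c).add differentiableAt_id)).differentiableWithinAt
  have hsc : s - c = ((s.re - 2 : ℝ) : ℂ) := by
    apply Complex.ext <;> simp [hc, htd]
  have hn : ‖s - c‖ = 2 - s.re := by
    rw [hsc, Complex.norm_real, Real.norm_eq_abs, abs_of_nonpos (by linarith)]; ring
  have key := Complex.borelCaratheodory (M := 7 * t) (R := 3 / 2) (z := s - c) (by linarith) hd
    hM (by norm_num) (by rw [mem_ball_zero_iff, hn]; linarith)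
  rw [hn, add_sub_cancel, add_zero] at key
  have hcq : c ∈ critQuadrant := by simpa using (hmem 0 (by simp)).1
  have hfc : ‖f c‖ ≤ logZetaTwo := by
    have hre : c.re = 2 := by simp [hc]
    rw [hf.eq_series c hcq (by rw [hre]; norm_num)]
    exact norm_logZetaSeries_le hre
  have hE := logZetaTwo_nonneg
  refine key.trans ?_
  rw [show (3 / 2 - (2 - s.re) : ℝ) = s.re - 1 / 2 by ring, ← add_div]
  refine div_le_div_of_nonneg_right ?_ (by linarith)
  have e1 : 2 * (7 * t) * (2 - s.re) ≤ 21 * t := by nlinarith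
  have e2 : ‖f c‖ * (3 / 2 + (2 - s.re)) ≤ logZetaTwo * 3 := by
    refine mul_le_mul hfc (by linarith) (by linarith) hE
  nlinarith

/-! ### The kernel and its Fourier transform. -/

/-- The kernel `e^{-u²/2} (1 + sin λu)`. -/
noncomputable def sineGaussian (l : ℝ) (u : ℂ) : ℂ :=
  Complex.exp (-u ^ 2 / 2) * (1 + Complex.sin (l * u))

/-- The Fourier transform `∫ e^{-iξx} sineGaussian l x dx`. -/
noncomputable def sineGaussianHat (l ξ : ℝ) : ℂ :=
  Real.sqrt (2 * Real.pi) * (Real.exp (-ξ ^ 2 / 2) +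
    (Real.exp (-(ξ - l) ^ 2 / 2) - Real.exp (-(ξ + l) ^ 2 / 2)) / (2 * Complex.I))

theorem sineGaussian_ofReal (l x : ℝ) :
    sineGaussian l x = ((Real.exp (-x ^ 2 / 2) * (1 + Real.sin (l * x)) : ℝ) : ℂ) := by
  unfold sineGaussian
  push_cast
  rfl

theorem differentiable_sineGaussian (l : ℝ) : Differentiable ℂ (sineGaussian l) := by
  unfold sineGaussian
  fun_prop

theorem continuous_sineGaussian (l : ℝ) : Continuous (sineGaussian l) :=
  (differentiable_sineGaussian l).continuous

theorem norm_exp_neg_sq_div_two (x y : ℝ) :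
    ‖Complex.exp (-(x + y * Complex.I) ^ 2 / 2)‖ = Real.exp (y ^ 2 / 2 - x ^ 2 / 2) := by
  rw [Complex.norm_exp]
  congr 1
  have : (-(x + y * Complex.I) ^ 2 / 2 : ℂ) =
      ((y ^ 2 / 2 - x ^ 2 / 2 : ℝ) : ℂ) + ((-(x * y) : ℝ) : ℂ) * Complex.I := by
    push_cast
    linear_combination (-(y : ℂ) ^ 2 / 2) * Complex.I_sq
  rw [this, Complex.add_re, Complex.ofReal_re, Complex.re_ofReal_mul, Complex.I_re]
  ring

theorem norm_sin_le_exp (z : ℂ) : ‖Complex.sin z‖ ≤ Real.exp |z.im| := by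
  have h : Complex.sin z = (Complex.exp (-z * Complex.I) - Complex.exp (z * Complex.I)) *
      Complex.I / 2 := rfl
  rw [h, norm_div, norm_mul, Complex.norm_I, mul_one, div_le_iff₀ (by norm_num)]
  refine (norm_sub_le _ _).trans ?_
  rw [Complex.norm_exp, Complex.norm_exp]
  have h1 : (-z * Complex.I).re = z.im := by simp
  have h2 : (z * Complex.I).re = -z.im := by simp
  rw [h1, h2]
  have e1 := Real.exp_le_exp.2 (le_abs_self z.im)
  have e2 := Real.exp_le_exp.2 (neg_le_abs z.im)
  norm_num
  linarith

theorem norm_sineGaussian_le (l x y : ℝ) :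
    ‖sineGaussian l (x + y * Complex.I)‖ ≤
      2 * Real.exp (y ^ 2 / 2 + |l * y|) * Real.exp (-x ^ 2 / 2) := by
  unfold sineGaussian
  rw [norm_mul, norm_exp_neg_sq_div_two]
  have h1 : ‖1 + Complex.sin (l * (x + y * Complex.I))‖ ≤ 2 * Real.exp |l * y| := by
    refine (norm_add_le _ _).trans ?_
    have h2 := norm_sin_le_exp (l * (x + y * Complex.I))
    have h3 : (l * (x + y * Complex.I) : ℂ).im = l * y := by simp
    rw [h3] at h2
    have h4 := Real.one_le_exp (abs_nonneg (l * y))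
    rw [norm_one]
    linarith
  calc _ ≤ Real.exp (y ^ 2 / 2 - x ^ 2 / 2) * (2 * Real.exp |l * y|) := by gcongr
    _ = _ := by
      rw [show y ^ 2 / 2 - x ^ 2 / 2 = y ^ 2 / 2 + (-x ^ 2 / 2) by ring, Real.exp_add, Real.exp_add]
      ring

/-- Where `sin lx = -1` the second factor becomes `1 - cosh ly`, which vanishes at `y = 0`. The
factor `|y|` is what the vertical sides of the contour need. -/
theorem norm_sineGaussian_le_of_sin_eq {l x : ℝ} (hx : Real.sin (l * x) = -1) (y : ℝ) :
    ‖sineGaussian l (x + y * Complex.I)‖ ≤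
      |y| * Real.exp (y ^ 2 / 2 + 2 * |l| + |l * y|) * Real.exp (-x ^ 2 / 2) := by
  unfold sineGaussian
  rw [norm_mul, norm_exp_neg_sq_div_two]
  have hcos : Real.cos (l * x) = 0 := by
    have := Real.sin_sq_add_cos_sq (l * x)
    rw [hx] at this
    nlinarith
  have h0 : 1 + Complex.sin (l * (x + y * Complex.I)) = ((1 - Real.cosh (l * y) : ℝ) : ℂ) := by
    have : (l * (x + y * Complex.I) : ℂ) = ((l * x : ℝ) : ℂ) + ((l * y : ℝ) : ℂ) * Complex.I := by
      push_cast; ring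
    rw [this, Complex.sin_add, Complex.cos_mul_I, ← Complex.ofReal_sin, ← Complex.ofReal_cos, hx,
      hcos]
    push_cast
    ring
  have h1 : ‖1 + Complex.sin (l * (x + y * Complex.I))‖ ≤ |l * y| * Real.exp |l * y| := by
    rw [h0, Complex.norm_real, Real.norm_eq_abs, abs_sub_comm,
      abs_of_nonneg (by linarith [Real.one_le_cosh (l * y)]), ← Real.cosh_abs]
    set z := |l * y| with hz
    have hz0 : 0 ≤ z := abs_nonneg _
    rw [Real.cosh_eq]
    have e1 : Real.exp (-z) ≤ 1 := Real.exp_le_one_iff.2 (by linarith)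
    have e2 := Real.add_one_le_exp (-z)
    have e3 : Real.exp z * Real.exp (-z) = 1 := by rw [← Real.exp_add]; simp
    have e4 := Real.exp_pos z
    nlinarith
  have h2 : |l * y| ≤ |y| * Real.exp (2 * |l|) := by
    rw [abs_mul, mul_comm]
    gcongr
    have := Real.add_one_le_exp (2 * |l|)
    have := abs_nonneg l
    linarith
  calc _ ≤ Real.exp (y ^ 2 / 2 - x ^ 2 / 2) * (|y| * Real.exp (2 * |l|) * Real.exp |l * y|) := by
        gcongr
        exact h1.trans (by gcongr)
    _ = _ := by
      rw [show y ^ 2 / 2 - x ^ 2 / 2 = y ^ 2 / 2 + (-x ^ 2 / 2) by ring, Real.exp_add, Real.exp_add,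
        Real.exp_add]
      ring

/-- Both factors are evaluated on the line shifted by `k`, so all dependence on `k` cancels when the
square is completed. -/
theorem integral_exp_mul_gaussian (s : ℂ) (k c ξ : ℝ) :
    MeasureTheory.Integrable (fun x : ℝ => Complex.exp (-(s + k + x * Complex.I) * ξ) *
      (Complex.exp (-(x + (-k : ℝ) * Complex.I) ^ 2 / 2) *
        Complex.exp (c * (x + (-k : ℝ) * Complex.I) * Complex.I))) ∧
    ∫ x : ℝ, Complex.exp (-(s + k + x * Complex.I) * ξ) *
      (Complex.exp (-(x + (-k : ℝ) * Complex.I) ^ 2 / 2) *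
        Complex.exp (c * (x + (-k : ℝ) * Complex.I) * Complex.I)) =
      Complex.exp (-s * ξ) * (Real.sqrt (2 * Real.pi) * Real.exp (-(ξ - c) ^ 2 / 2)) := by
  have hfun : (fun x : ℝ => Complex.exp (-(s + k + x * Complex.I) * ξ) *
      (Complex.exp (-(x + (-k : ℝ) * Complex.I) ^ 2 / 2) *
        Complex.exp (c * (x + (-k : ℝ) * Complex.I) * Complex.I))) =
      fun x : ℝ => Complex.exp (-(1 / 2) * x ^ 2 + ((k + c - ξ) * Complex.I) * x +
        (k ^ 2 / 2 + c * k - s * ξ - k * ξ)) := by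
    funext x
    rw [← Complex.exp_add, ← Complex.exp_add]
    congr 1
    push_cast
    linear_combination (-(k : ℂ) ^ 2 / 2 - c * k) * Complex.I_sq
  have hb : (-(1 / 2) : ℂ).re < 0 := by norm_num
  rw [hfun]
  refine ⟨integrable_cexp_quadratic' hb _ _, ?_⟩
  rw [integral_cexp_quadratic hb]
  have h1 : ((Real.pi : ℂ) / -(-(1 / 2))) ^ (1 / 2 : ℂ) = (Real.sqrt (2 * Real.pi) : ℝ) := by
    rw [Real.sqrt_eq_rpow, Complex.ofReal_cpow (by positivity)]
    congr 1
    · push_cast; ring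
    · norm_num
  rw [h1, Complex.ofReal_exp, mul_left_comm, ← Complex.exp_add]
  congr 2
  push_cast
  linear_combination ((k + c - ξ : ℂ) ^ 2 / 2) * Complex.I_sq

theorem integral_exp_mul_sineGaussian (s : ℂ) (k l ξ : ℝ) :
    ∫ x : ℝ, Complex.exp (-(s + k + x * Complex.I) * ξ) *
      sineGaussian l (x + (-k : ℝ) * Complex.I) = Complex.exp (-s * ξ) * sineGaussianHat l ξ := by
  obtain ⟨i0, e0⟩ := integral_exp_mul_gaussian s k 0 ξ
  obtain ⟨i1, e1⟩ := integral_exp_mul_gaussian s k l ξ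
  obtain ⟨i2, e2⟩ := integral_exp_mul_gaussian s k (-l) ξ
  have hsum : ∀ x : ℝ, Complex.exp (-(s + k + x * Complex.I) * ξ) *
      sineGaussian l (x + (-k : ℝ) * Complex.I) =
      Complex.exp (-(s + k + x * Complex.I) * ξ) *
      (Complex.exp (-(x + (-k : ℝ) * Complex.I) ^ 2 / 2) *
        Complex.exp ((0 : ℝ) * (x + (-k : ℝ) * Complex.I) * Complex.I)) +
      (Complex.exp (-(s + k + x * Complex.I) * ξ) *
      (Complex.exp (-(x + (-k : ℝ) * Complex.I) ^ 2 / 2) *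
        Complex.exp (l * (x + (-k : ℝ) * Complex.I) * Complex.I)) -
      Complex.exp (-(s + k + x * Complex.I) * ξ) *
      (Complex.exp (-(x + (-k : ℝ) * Complex.I) ^ 2 / 2) *
        Complex.exp ((-l : ℝ) * (x + (-k : ℝ) * Complex.I) * Complex.I))) / (2 * Complex.I) := by
    intro x
    have hsin : Complex.sin (l * (x + (-k : ℝ) * Complex.I)) =
        (Complex.exp (l * (x + (-k : ℝ) * Complex.I) * Complex.I) -
          Complex.exp ((-l : ℝ) * (x + (-k : ℝ) * Complex.I) * Complex.I)) / (2 * Complex.I) := by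
      have h : ∀ z : ℂ, Complex.sin z = (Complex.exp (-z * Complex.I) - Complex.exp (z * Complex.I)) *
        Complex.I / 2 := fun _ => rfl
      rw [h, eq_div_iff (by simp [Complex.I_ne_zero])]
      push_cast
      rw [← neg_mul]
      linear_combination (Complex.exp (-(l : ℂ) * (x + -(k : ℂ) * Complex.I) * Complex.I) -
        Complex.exp ((l : ℂ) * (x + -(k : ℂ) * Complex.I) * Complex.I)) * Complex.I_sq
    unfold sineGaussian
    rw [hsin, Complex.ofReal_zero, zero_mul, zero_mul, Complex.exp_zero]
    ring
  have hcomb : ∀ {A B D : ℝ → ℂ} (_ : MeasureTheory.Integrable A) (_ : MeasureTheory.Integrable B)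
      (_ : MeasureTheory.Integrable D) (z : ℂ),
      ∫ x, (A x + (B x - D x) / z) = (∫ x, A x) + ((∫ x, B x) - ∫ x, D x) / z := by
    intro A B D hA hB hD z
    have hBD : MeasureTheory.Integrable (fun x => (B x - D x) / z) := (hB.sub hD).div_const z
    rw [MeasureTheory.integral_add hA hBD, MeasureTheory.integral_div,
      MeasureTheory.integral_sub hB hD]
  rw [MeasureTheory.integral_congr_ae (Eventually.of_forall hsum), hcomb i0 i1 i2, e0, e1, e2]
  unfold sineGaussianHat
  rw [sub_zero, sub_neg_eq_add]
  ring

/-! ### Moving the contour to `Re s = 2`. -/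

theorem logZeta_term_eq (s : ℂ) (n : ℕ) :
    LSeries.term (fun n => (logZetaCoeff n : ℂ)) s n =
      logZetaCoeff n * Complex.exp (-s * (Real.log n : ℝ)) := by
  rcases eq_or_ne n 0 with rfl | hn
  · simp [logZetaCoeff_zero]
  · rw [LSeries.term_of_ne_zero hn, Complex.cpow_def_of_ne_zero (by exact_mod_cast hn),
      div_eq_mul_inv, ← Complex.exp_neg, Complex.natCast_log]
    congr 2
    ring

theorem norm_sineGaussian_shift_le {l k : ℝ} (hk0 : 0 ≤ k) (hk : k ≤ 3 / 2) (x : ℝ) :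
    ‖sineGaussian l (x + (-k : ℝ) * Complex.I)‖ ≤
      2 * Real.exp (9 / 8 + 3 / 2 * |l|) * Real.exp (-x ^ 2 / 2) := by
  refine (norm_sineGaussian_le l x (-k)).trans ?_
  have h1 : |l * -k| ≤ 3 / 2 * |l| := by
    rw [abs_mul, abs_neg, abs_of_nonneg hk0, mul_comm]
    gcongr
  have h2 : (-k) ^ 2 / 2 + |l * -k| ≤ 9 / 8 + 3 / 2 * |l| := by nlinarith
  gcongr

theorem integrable_exp_neg_sq_div (c : ℝ) (hc : 0 < c) :
    MeasureTheory.Integrable fun x : ℝ => Real.exp (-x ^ 2 / c) := by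
  have := integrable_exp_neg_mul_sq (b := 1 / c) (by positivity)
  refine this.congr (Eventually.of_forall fun x => ?_)
  simp only
  congr 1
  ring

theorem integrable_sineGaussian_shift {l k : ℝ} (hk0 : 0 ≤ k) (hk : k ≤ 3 / 2) :
    MeasureTheory.Integrable fun x : ℝ => sineGaussian l (x + (-k : ℝ) * Complex.I) := by
  refine ((integrable_exp_neg_sq_div 2 two_pos).const_mul
    (2 * Real.exp (9 / 8 + 3 / 2 * |l|))).mono' ?_
    (Eventually.of_forall fun x => norm_sineGaussian_shift_le hk0 hk x)
  exact ((continuous_sineGaussian l).comp (by fun_prop)).aestronglyMeasurable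

theorem hasSum_integral_logZetaSeries_mul {s : ℂ} {k l : ℝ} (hk0 : 0 ≤ k) (hk : k ≤ 3 / 2)
    (hs : s.re + k = 2) :
    HasSum (fun n : ℕ => (logZetaCoeff n : ℂ) *
        (Complex.exp (-s * (Real.log n : ℝ)) * sineGaussianHat l (Real.log n)))
      (∫ x : ℝ, logZetaSeries (s + k + x * Complex.I) *
        sineGaussian l (x + (-k : ℝ) * Complex.I)) := by
  have hre : ∀ x : ℝ, (s + k + x * Complex.I).re = 2 := fun x => by simpa using hs
  set F : ℕ → ℝ → ℂ := fun n x => LSeries.term (fun n => (logZetaCoeff n : ℂ))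
    (s + k + x * Complex.I) n * sineGaussian l (x + (-k : ℝ) * Complex.I) with hF
  have hFn : ∀ n x, ‖F n x‖ = ‖LSeries.term (fun n => (logZetaCoeff n : ℂ)) 2 n‖ *
      ‖sineGaussian l (x + (-k : ℝ) * Complex.I)‖ := fun n x => by
    rw [hF]
    simp only
    rw [norm_mul, norm_logZeta_term_eq (hre x)]
  have hint := integrable_sineGaussian_shift (l := l) hk0 hk
  have hFi : ∀ n, MeasureTheory.Integrable (F n) := by
    intro n
    refine (hint.norm.const_mul ‖LSeries.term (fun n => (logZetaCoeff n : ℂ)) 2 n‖).mono' ?_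
      (Eventually.of_forall fun x => (hFn n x).le)
    refine Continuous.aestronglyMeasurable ?_
    simp only [hF, logZeta_term_eq]
    exact (by fun_prop : Continuous fun x : ℝ => (logZetaCoeff n : ℂ) *
      Complex.exp (-(s + k + x * Complex.I) * (Real.log n : ℝ))).mul
      ((continuous_sineGaussian l).comp (by fun_prop))
  have h := MeasureTheory.hasSum_integral_of_summable_integral_norm hFi (by
    simp_rw [hFn, MeasureTheory.integral_const_mul]
    exact summable_norm_logZeta_term.mul_right _)
  have e1 : ∀ n, ∫ x, F n x = (logZetaCoeff n : ℂ) *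
      (Complex.exp (-s * (Real.log n : ℝ)) * sineGaussianHat l (Real.log n)) := by
    intro n
    rw [← integral_exp_mul_sineGaussian s k l, ← MeasureTheory.integral_const_mul]
    refine MeasureTheory.integral_congr_ae (Eventually.of_forall fun x => ?_)
    simp only [hF, logZeta_term_eq, mul_assoc]
  have e2 : ∀ x, ∑' n, F n x = logZetaSeries (s + k + x * Complex.I) *
        sineGaussian l (x + (-k : ℝ) * Complex.I) := by
    intro x
    simp only [hF, logZetaSeries, LSeries, tsum_mul_right]
  simp_rw [e1, e2] at h
  exact h

theorem norm_integral_logZetaSeries_mul_sub_le {s : ℂ} {k l a b U : ℝ} (hk0 : 0 ≤ k)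
    (hk : k ≤ 3 / 2) (hs : s.re + k = 2) (hU : 0 ≤ U) (ha : a ≤ -U) (hb : U ≤ b) :
    ‖(∫ x in a..b, logZetaSeries (s + k + x * Complex.I) *
        sineGaussian l (x + (-k : ℝ) * Complex.I)) -
      ∫ x : ℝ, logZetaSeries (s + k + x * Complex.I) *
        sineGaussian l (x + (-k : ℝ) * Complex.I)‖ ≤
      logZetaTwo * (2 * Real.exp (9 / 8 + 3 / 2 * |l|)) * Real.exp (-U ^ 2 / 4) *
        Real.sqrt (4 * Real.pi) := by
  have hre : ∀ x : ℝ, (s + k + x * Complex.I).re = 2 := fun x => by simpa using hs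
  set g : ℝ → ℂ := fun x => logZetaSeries (s + k + x * Complex.I) *
        sineGaussian l (x + (-k : ℝ) * Complex.I) with hg
  set B := logZetaTwo * (2 * Real.exp (9 / 8 + 3 / 2 * |l|)) with hB
  have hB0 : 0 ≤ B := mul_nonneg logZetaTwo_nonneg (by positivity)
  have hgn : ∀ x, ‖g x‖ ≤ B * Real.exp (-x ^ 2 / 2) := by
    intro x
    rw [hg]
    simp only
    rw [norm_mul, hB, mul_assoc]
    exact mul_le_mul (norm_logZetaSeries_le (hre x)) (norm_sineGaussian_shift_le hk0 hk x)
      (norm_nonneg _) logZetaTwo_nonneg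
  have hgc : Continuous g := by
    refine Continuous.mul ?_ ((continuous_sineGaussian l).comp (by fun_prop))
    rw [continuous_iff_continuousAt]
    intro x
    refine ContinuousAt.comp (g := logZetaSeries)
      (hasDerivAt_logZetaSeries (by rw [hre]; norm_num)).continuousAt ?_
    fun_prop
  have hgi : MeasureTheory.Integrable g :=
    ((integrable_exp_neg_sq_div 2 two_pos).const_mul B).mono' hgc.aestronglyMeasurable
      (Eventually.of_forall hgn)
  have hab : a ≤ b := by linarith
  rw [intervalIntegral.integral_of_le hab,
    ← MeasureTheory.integral_add_compl measurableSet_Ioc hgi, sub_add_cancel_left, norm_neg]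
  have hgi4 := (integrable_exp_neg_sq_div 4 four_pos).const_mul (B * Real.exp (-U ^ 2 / 4))
  refine (MeasureTheory.norm_integral_le_of_norm_le hgi4.integrableOn ?_).trans
    ((MeasureTheory.setIntegral_le_integral hgi4 (Eventually.of_forall fun x => ?_)).trans ?_)
  · filter_upwards [MeasureTheory.ae_restrict_mem measurableSet_Ioc.compl] with x hx
    refine (hgn x).trans ?_
    rw [mul_assoc B, ← Real.exp_add]
    have : U ^ 2 ≤ x ^ 2 := by
      -- Outside the window `|x| ≥ U`, so half of the Gaussian exponent yields `e^{-U²/4}` and the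
      -- other half remains integrable.
      rw [mem_compl_iff, mem_Ioc, not_and_or, not_lt, not_le] at hx
      rcases hx with hx | hx <;> nlinarith
    gcongr
    linarith
  · positivity
  · rw [MeasureTheory.integral_const_mul]
    refine mul_le_mul_of_nonneg_left (le_of_eq ?_) (by positivity)
    have := integral_gaussian (1 / 4)
    rw [show Real.pi / (1 / 4) = 4 * Real.pi by ring] at this
    rw [← this]
    congr 1
    ext x
    congr 1
    ring

theorem IsLogZeta.norm_vertical_integral_le {f : ℂ → ℂ} (hf : IsLogZeta f) {t l x η U : ℝ}
    (hη : 0 < η) (hη' : η ≤ 1 / 2) (hU : 0 ≤ U) (hx : U ≤ |x|) (htx : 2 ≤ t + x)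
    (hsin : Real.sin (l * x) = -1) :
    ‖∫ y in (-(3 / 2 - η))..0, f ((1 / 2 + η : ℝ) + Complex.I * (t + (x + y * Complex.I))) *
        sineGaussian l (x + y * Complex.I)‖ ≤
      (21 + 3 * logZetaTwo) * (t + x) * Real.exp (9 / 8 + 7 / 2 * |l|) * Real.exp (-U ^ 2 / 4) *
        (3 / 2) := by
  have hE := logZetaTwo_nonneg
  refine (intervalIntegral.norm_integral_le_of_norm_le_const (C :=
    (21 + 3 * logZetaTwo) * (t + x) * Real.exp (9 / 8 + 7 / 2 * |l|) * Real.exp (-U ^ 2 / 4))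
    fun y hy => ?_).trans ?_
  · rw [uIoc_of_le (by linarith)] at hy
    obtain ⟨hy1, hy2⟩ := hy
    set s : ℂ := (1 / 2 + η : ℝ) + Complex.I * (t + (x + y * Complex.I)) with hs
    have hre : s.re = 1 / 2 + η - y := by simp [hs]; ring
    have him : s.im = t + x := by simp [hs]
    have h1 := hf.norm_le (s := s) (by rw [hre]; linarith) (by rw [hre]; linarith) (by rwa [him])
    rw [hre, him, show 1 / 2 + η - y - 1 / 2 = η - y by ring] at h1
    have h2 := norm_sineGaussian_le_of_sin_eq hsin y
    rw [abs_of_nonpos hy2] at h2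
    have hU2 : U ^ 2 ≤ x ^ 2 := by rw [← sq_abs x]; gcongr
    have h3 : Real.exp (y ^ 2 / 2 + 2 * |l| + |l * y|) ≤ Real.exp (9 / 8 + 7 / 2 * |l|) := by
      have : |l * y| ≤ |l| * (3 / 2) := by
        rw [abs_mul, abs_of_nonpos hy2]
        gcongr
        linarith
      exact Real.exp_le_exp.2 (by nlinarith)
    have h4 : Real.exp (-x ^ 2 / 2) ≤ Real.exp (-U ^ 2 / 4) := by
      exact Real.exp_le_exp.2 (by nlinarith)
    rw [norm_mul]
    have hd : 0 < η - y := by linarith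
    calc ‖f s‖ * ‖sineGaussian l (x + y * Complex.I)‖ ≤
        ((21 + 3 * logZetaTwo) * (t + x) / (η - y)) *
          (-y * Real.exp (9 / 8 + 7 / 2 * |l|) * Real.exp (-U ^ 2 / 4)) := by
          refine mul_le_mul h1 (h2.trans ?_) (norm_nonneg _) (by positivity)
          have : 0 ≤ -y := by linarith
          gcongr
      _ = ((21 + 3 * logZetaTwo) * (t + x) * Real.exp (9 / 8 + 7 / 2 * |l|) *
          Real.exp (-U ^ 2 / 4)) * (-y / (η - y)) := by ring
      _ ≤ _ := by
          -- The distance `η - y` to the critical line in the bound for `f` is absorbed by the zero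
          -- `-y` of the kernel, uniformly in `η`.
          refine mul_le_of_le_one_right (by positivity) ?_
          rw [div_le_one hd]
          linarith
  · refine mul_le_mul_of_nonneg_left ?_ (by positivity)
    rw [abs_of_nonneg (by linarith)]
    linarith

/-- Cauchy's theorem on a rectangle whose vertical sides in the `u`-plane stand at zeros of the
kernel. The constant `C` does not depend on `η`, which permits `η → 0` afterwards. -/
theorem exists_norm_integral_sub_sum_le : ∃ C > 0, ∀ f : ℂ → ℂ, IsLogZeta f →
    ∀ t l a b η U : ℝ, 0 < η → η ≤ 1 / 2 → 0 ≤ U → a ≤ -U → U ≤ b → 2 ≤ t + a →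
    Real.sin (l * a) = -1 → Real.sin (l * b) = -1 →
    Summable (fun n : ℕ => (logZetaCoeff n : ℂ) *
      (Complex.exp (-((1 / 2 + η : ℝ) + t * Complex.I) * (Real.log n : ℝ)) *
        sineGaussianHat l (Real.log n))) ∧
    ‖(∫ x in a..b, f ((1 / 2 + η : ℝ) + (t + x : ℝ) * Complex.I) * sineGaussian l x) -
      ∑' n : ℕ, (logZetaCoeff n : ℂ) *
        (Complex.exp (-((1 / 2 + η : ℝ) + t * Complex.I) * (Real.log n : ℝ)) *
          sineGaussianHat l (Real.log n))‖ ≤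
      C * (t + b) * Real.exp (4 * |l|) * Real.exp (-U ^ 2 / 4) := by
  have hE := logZetaTwo_nonneg
  refine ⟨Real.exp (9 / 8) * (2 * logZetaTwo * Real.sqrt (4 * Real.pi) +
    3 * (21 + 3 * logZetaTwo)), by positivity, ?_⟩
  intro f hf t l a b η U hη hη' hU ha hb hta hsa hsb
  set s : ℂ := (1 / 2 + η : ℝ) + t * Complex.I with hs
  set k : ℝ := 3 / 2 - η with hk
  have hk0 : 0 ≤ k := by linarith
  have hk1 : k ≤ 3 / 2 := by linarith
  have hsk : s.re + k = 2 := by simp [hs, hk]; ring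
  have hsum := hasSum_integral_logZetaSeries_mul (l := l) hk0 hk1 hsk
  refine ⟨hsum.summable, ?_⟩
  rw [hsum.tsum_eq]
  have hab : a ≤ b := by linarith
  set h : ℂ → ℂ := fun u => f ((1 / 2 + η : ℝ) + Complex.I * (t + u)) * sineGaussian l u with hh
  have hmem : ∀ u : ℂ, a ≤ u.re → u.im ≤ 0 →
      ((1 / 2 + η : ℝ) + Complex.I * (t + u) : ℂ) ∈ critQuadrant := by
    intro u h1 h2
    constructor
    · simp; linarith
    · simp; linarith
  -- With `s = 1/2 + η + i(t + u)`, going down to `Im u = -k` moves `Re s` right, from `1/2 + η` to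
  -- `2`.
  have hrect := Complex.integral_boundary_rect_eq_zero_of_differentiableOn h ⟨a, -k⟩ ⟨b, 0⟩ (by
    intro u hu
    rw [Complex.mem_reProdIm] at hu
    simp only at hu
    rw [uIcc_of_le hab, uIcc_of_le (by linarith)] at hu
    refine DifferentiableAt.differentiableWithinAt ?_
    refine DifferentiableAt.mul ?_ (differentiable_sineGaussian l u)
    refine DifferentiableAt.comp u (g := f) (hf.differentiableOn.differentiableAt
      (isOpen_critQuadrant.mem_nhds (hmem u hu.1.1 hu.2.2))) ?_
    fun_prop)
  simp only [smul_eq_mul, Complex.ofReal_zero, zero_mul, add_zero] at hrect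
  have e1 : ∫ x in a..b, h x =
      ∫ x in a..b, f ((1 / 2 + η : ℝ) + (t + x : ℝ) * Complex.I) * sineGaussian l x := by
    refine intervalIntegral.integral_congr fun x _ => ?_
    simp only [hh]
    congr 3
    push_cast
    ring
  have e2 : ∫ x in a..b, h (x + (-k : ℝ) * Complex.I) =
      ∫ x in a..b, logZetaSeries (s + k + x * Complex.I) *
        sineGaussian l (x + (-k : ℝ) * Complex.I) := by
    refine intervalIntegral.integral_congr fun x hx => ?_
    rw [uIcc_of_le hab] at hx
    simp only [hh]
    have hz : ((1 / 2 + η : ℝ) + Complex.I * (t + (x + (-k : ℝ) * Complex.I)) : ℂ) =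
        s + k + x * Complex.I := by
      rw [hs]
      push_cast
      linear_combination (-(k : ℂ)) * Complex.I_sq
    have hq := hmem (x + (-k : ℝ) * Complex.I) (by simpa using hx.1) (by simpa using hk0)
    rw [hz] at hq
    rw [hz, hf.eq_series _ hq]
    have : (s + k + x * Complex.I).re = 2 := by simpa using hsk
    rw [this]; norm_num
  rw [e1, e2] at hrect
  have n1 := norm_integral_logZetaSeries_mul_sub_le (l := l) hk0 hk1 hsk hU ha hb
  have n2 := hf.norm_vertical_integral_le hη hη' hU (x := b) (t := t)
    (by rw [abs_of_nonneg (by linarith)]; exact hb) (by linarith) hsb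
  have n3 := hf.norm_vertical_integral_le hη hη' hU (x := a) (t := t)
    (by rw [abs_of_nonpos (by linarith)]; linarith) (by linarith) hsa
  set X1 := ∫ x in a..b, logZetaSeries (s + k + x * Complex.I) *
        sineGaussian l (x + (-k : ℝ) * Complex.I)
  set X2 := ∫ x : ℝ, logZetaSeries (s + k + x * Complex.I) *
        sineGaussian l (x + (-k : ℝ) * Complex.I)
  set Vb := ∫ y in (-k)..0, f ((1 / 2 + η : ℝ) + Complex.I * (t + (b + y * Complex.I))) *
        sineGaussian l (b + y * Complex.I)
  set Va := ∫ y in (-k)..0, f ((1 / 2 + η : ℝ) + Complex.I * (t + (a + y * Complex.I))) *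
        sineGaussian l (a + y * Complex.I)
  set Z := ∫ x in a..b, f ((1 / 2 + η : ℝ) + (t + x : ℝ) * Complex.I) * sineGaussian l x
  have hZ : Z - X2 = (X1 - X2) + (Complex.I * Vb - Complex.I * Va) := by
    linear_combination -hrect
  rw [hZ]
  have n4 : ‖(X1 - X2) + (Complex.I * Vb - Complex.I * Va)‖ ≤ ‖X1 - X2‖ + (‖Vb‖ + ‖Va‖) := by
    refine (norm_add_le _ _).trans ?_
    gcongr
    refine (norm_sub_le _ _).trans ?_
    simp
  refine n4.trans ?_
  have x1 : Real.exp (9 / 8 + 3 / 2 * |l|) ≤ Real.exp (9 / 8) * Real.exp (4 * |l|) := by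
    rw [← Real.exp_add]
    gcongr
    norm_num
  have x2 : Real.exp (9 / 8 + 7 / 2 * |l|) ≤ Real.exp (9 / 8) * Real.exp (4 * |l|) := by
    rw [← Real.exp_add]
    gcongr
    norm_num
  set e4 := Real.exp (4 * |l|)
  set eU := Real.exp (-U ^ 2 / 4)
  set e9 := Real.exp (9 / 8)
  have hV : ∀ x ≤ b, 2 ≤ t + x → (21 + 3 * logZetaTwo) * (t + x) *
      Real.exp (9 / 8 + 7 / 2 * |l|) * eU * (3 / 2) ≤
      (21 + 3 * logZetaTwo) * (t + b) * (e9 * e4) * eU * (3 / 2) := by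
    intro x hx htx
    have : 0 ≤ t + x := by linarith
    have : 0 ≤ t + b := by linarith
    gcongr
  have n5 : ‖X1 - X2‖ ≤ (t + b) * (logZetaTwo * (2 * (e9 * e4)) * eU * Real.sqrt (4 * Real.pi)) := by
    refine n1.trans ?_
    refine le_trans ?_ (le_mul_of_one_le_left (by positivity) (by linarith))
    gcongr
  have n6 := n2.trans (hV b le_rfl (by linarith))
  have n7 := n3.trans (hV a hab hta)
  calc _ ≤ _ := add_le_add n5 (add_le_add n6 n7)
    _ = _ := by ring

/-! ### Dirichlet's simultaneous approximation. -/

/-- Pigeonhole: `q ^ P.card + 1` multiples fall into `q ^ P.card` boxes of side `1/q`; the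
difference of two in one box is the required `k`. -/
theorem exists_simultaneous_approx {ι : Type*} (P : Finset ι) (α : ι → ℝ) {q : ℕ} (hq : 0 < q) :
    ∃ k : ℕ, 1 ≤ k ∧ k ≤ q ^ P.card ∧ ∀ i ∈ P, ∃ m : ℤ, |k * α i - m| ≤ 1 / q := by
  have hq' : (0 : ℝ) < q := by exact_mod_cast hq
  have hlt : ∀ x : ℝ, ⌊q * Int.fract x⌋₊ < q := fun x => by
    rw [Nat.floor_lt (by have := Int.fract_nonneg x; positivity)]
    exact mul_lt_of_lt_one_right hq' (Int.fract_lt_one x)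
  let F : Fin (q ^ P.card + 1) → (P → Fin q) := fun k i =>
    ⟨⌊q * Int.fract ((k : ℕ) * α i)⌋₊, hlt _⟩
  have key : ∀ k l : Fin (q ^ P.card + 1), k < l → F k = F l → ∃ k : ℕ, 1 ≤ k ∧ k ≤ q ^ P.card ∧
      ∀ i ∈ P, ∃ m : ℤ, |k * α i - m| ≤ 1 / q := by
    intro k l hkl hF
    have hkl' : (k : ℕ) < l := hkl
    refine ⟨l - k, by omega, by omega, fun i hi => ?_⟩
    refine ⟨⌊(l : ℕ) * α i⌋ - ⌊(k : ℕ) * α i⌋, ?_⟩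
    have h := congrArg Fin.val (congrFun hF ⟨i, hi⟩)
    simp only [F] at h
    set x := ((k : ℕ) : ℝ) * α i with hx
    set y := ((l : ℕ) : ℝ) * α i with hy
    have hxy : ((l - k : ℕ) : ℝ) * α i = y - x := by
      rw [Nat.cast_sub hkl'.le]; ring
    rw [hxy]
    have e1 : y - x - ((⌊y⌋ - ⌊x⌋ : ℤ) : ℝ) = Int.fract y - Int.fract x := by
      push_cast
      rw [Int.fract, Int.fract]; ring
    rw [e1]
    have f1 := Nat.floor_le (mul_nonneg hq'.le (Int.fract_nonneg x))
    have f2 := Nat.lt_floor_add_one (q * Int.fract x)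
    have f3 := Nat.floor_le (mul_nonneg hq'.le (Int.fract_nonneg y))
    have f4 := Nat.lt_floor_add_one (q * Int.fract y)
    rw [h] at f1 f2
    have e2 : |Int.fract y - Int.fract x| * q = |(Int.fract y - Int.fract x) * q| := by
      rw [abs_mul, abs_of_pos hq']
    rw [le_div_iff₀ hq', e2, abs_le]
    constructor <;> nlinarith
  classical
  obtain ⟨k, l, hne, hF⟩ := Fintype.exists_ne_map_eq_of_card_lt F (by simp)
  rcases lt_or_gt_of_ne hne with h | h
  · exact key k l h hF
  · exact key l k h hF.symm

/-- Approximating to within `1/6` puts `t log n` within `π/3` of a multiple of `2π`. Taking `t` to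
be a positive multiple of `Y` prevents it from being small. -/
theorem exists_half_le_cos (P : Finset ℕ) {Y : ℝ} (hY : 0 < Y) :
    ∃ t : ℝ, Y ≤ t ∧ t ≤ 6 ^ P.card * Y ∧ ∀ n ∈ P, 1 / 2 ≤ Real.cos (t * Real.log n) := by
  obtain ⟨k, hk1, hk2, hk⟩ := exists_simultaneous_approx P
    (fun n => Y * Real.log n / (2 * Real.pi)) (q := 6) (by norm_num)
  have hk1' : (1 : ℝ) ≤ k := by exact_mod_cast hk1
  have hk2' : (k : ℝ) ≤ 6 ^ P.card := by exact_mod_cast hk2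
  refine ⟨k * Y, by nlinarith, by gcongr, fun n hn => ?_⟩
  obtain ⟨m, hm⟩ := hk n hn
  have hpi := Real.pi_pos
  set d : ℝ := k * (Y * Real.log n / (2 * Real.pi)) - m with hd
  have e : k * Y * Real.log n = 2 * Real.pi * d + m * (2 * Real.pi) := by
    rw [hd]; field_simp; ring
  rw [e, Real.cos_add_int_mul_two_pi, ← Real.cos_abs, ← Real.cos_pi_div_three]
  refine Real.cos_le_cos_of_nonneg_of_le_pi (abs_nonneg _) (by linarith) ?_
  rw [abs_mul, abs_of_pos (by positivity)]
  push_cast at hm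
  nlinarith

/-! ### Chebyshev estimates. -/

open scoped ArithmeticFunction.vonMangoldt in
theorem psi_natCast_succ (n : ℕ) :
    Chebyshev.psi ((n + 1 : ℕ) : ℝ) = Chebyshev.psi (n : ℝ) + Λ (n + 1) := by
  rw [Chebyshev.psi_eq_sum_Icc, Chebyshev.psi_eq_sum_Icc, Nat.floor_natCast, Nat.floor_natCast,
    Finset.sum_Icc_succ_top (by omega)]

theorem psi_le_six_mul {x : ℝ} (hx : 0 ≤ x) : Chebyshev.psi x ≤ 6 * x := by
  refine (Chebyshev.psi_le_const_mul_self hx).trans ?_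
  have h : Real.log 4 ≤ 2 := by
    rw [show (4 : ℝ) = 2 ^ 2 by norm_num, Real.log_pow]
    have := Real.log_two_lt_d9
    push_cast
    linarith
  gcongr
  linarith

open scoped ArithmeticFunction.vonMangoldt in
theorem sum_vonMangoldt_div_sq_le {M : ℕ} (hM : 1 ≤ M) (K : ℕ) (hK : M ≤ K) :
    ∑ n ∈ Finset.Ioc M K, Λ n / (n : ℝ) ^ 2 ≤ 12 / M := by
  have hM' : (1 : ℝ) ≤ M := by exact_mod_cast hM
  -- Partial summation as an induction: the boundary term `ψ(K)/K²` is carried along, and `ψ(x) ≤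
  -- 6x` controls each increment.
  have key : ∑ n ∈ Finset.Ioc M K, Λ n / (n : ℝ) ^ 2 ≤
      Chebyshev.psi (K : ℝ) / (K : ℝ) ^ 2 + 12 * (1 / M - 1 / K) := by
    induction K, hK using Nat.le_induction with
    | base =>
      simp only [Finset.Ioc_self, Finset.sum_empty, sub_self, mul_zero, add_zero]
      exact div_nonneg (Chebyshev.psi_nonneg _) (by positivity)
    | succ K hK ih =>
      rw [Finset.sum_Ioc_succ_top (by omega)]
      have h1 := psi_natCast_succ K
      have hK0 : (1 : ℝ) ≤ K := hM'.trans (by exact_mod_cast hK)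
      have h2 := psi_le_six_mul (x := (K : ℝ)) (by linarith)
      have h3 : Chebyshev.psi (K : ℝ) / (K : ℝ) ^ 2 + 12 * (1 / M - 1 / K) ≤
          Chebyshev.psi (K : ℝ) / ((K + 1 : ℕ) : ℝ) ^ 2 + 12 * (1 / M - 1 / ((K + 1 : ℕ) : ℝ)) := by
        have e : Chebyshev.psi (K : ℝ) / ((K + 1 : ℕ) : ℝ) ^ 2 + 12 * (1 / M - 1 / ((K + 1 : ℕ) : ℝ))
            - (Chebyshev.psi (K : ℝ) / (K : ℝ) ^ 2 + 12 * (1 / M - 1 / K)) =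
            (12 * (K * (K + 1)) - Chebyshev.psi (K : ℝ) * (2 * K + 1)) /
              ((K : ℝ) ^ 2 * (K + 1) ^ 2) := by
          push_cast
          field_simp
          ring
        have : 0 ≤ (12 * (K * (K + 1)) - Chebyshev.psi (K : ℝ) * (2 * K + 1)) /
              ((K : ℝ) ^ 2 * (K + 1) ^ 2) := by
          refine div_nonneg ?_ (by positivity)
          nlinarith
        linarith
      rw [h1, add_div]
      linarith
  refine key.trans ?_
  have hK0 : (1 : ℝ) ≤ K := hM'.trans (by exact_mod_cast hK)
  have h2 := psi_le_six_mul (x := (K : ℝ)) (by linarith)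
  have h3 : Chebyshev.psi (K : ℝ) / (K : ℝ) ^ 2 ≤ 6 * (1 / K) := by
    rw [div_le_iff₀ (by positivity)]
    refine h2.trans (le_of_eq ?_)
    field_simp
  have h4 : (0 : ℝ) ≤ 1 / K := by positivity
  have : (12 : ℝ) / M = 12 * (1 / M) := by ring
  linarith

-- The cut at `N/24` makes the discarded part at most `6 · N/24 = N/4`, while `ψ(N)` exceeds `N/2`.
open scoped ArithmeticFunction.vonMangoldt in
theorem div_four_le_sum_vonMangoldt {N : ℕ} (hN : 100 ≤ N) :
    (N : ℝ) / 4 ≤ ∑ n ∈ Finset.Ioc (N / 24) N, Λ n := by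
  have hN' : (100 : ℝ) ≤ N := by exact_mod_cast hN
  have hsub : ∑ n ∈ Finset.Ioc (N / 24) N, Λ n =
      Chebyshev.psi (N : ℝ) - Chebyshev.psi ((N / 24 : ℕ) : ℝ) := by
    rw [Chebyshev.psi, Chebyshev.psi, Nat.floor_natCast, Nat.floor_natCast,
      ← Finset.sum_Ioc_consecutive _ (Nat.zero_le (N / 24)) (Nat.div_le_self _ _)]
    ring
  rw [hsub]
  have h1 := Chebyshev.psi_ge N
  have h2 := psi_le_six_mul (x := ((N / 24 : ℕ) : ℝ)) (by positivity)
  have h3 : ((N / 24 : ℕ) : ℝ) ≤ N / 24 := Nat.cast_div_le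
  have h4 : Real.log (N + 1) ≤ N / 8 := by
    have h5 := Real.log_le_sub_one_of_pos (x := (N + 1 : ℝ) / 16) (by positivity)
    rw [Real.log_div (by positivity) (by norm_num), show (16 : ℝ) = 2 ^ 4 by norm_num,
      Real.log_pow] at h5
    have := Real.log_two_lt_d9
    push_cast at h5
    linarith
  have h6 := Real.log_two_gt_d9
  nlinarith

-- Primes are counted by Chebyshev's bound for `π`. Each higher prime power contributes at least
-- `log 2` to `ψ - θ`, which is `O(√x log x)`.
open scoped ArithmeticFunction.vonMangoldt in
theorem exists_card_vonMangoldt_ne_zero_le : ∃ C > 0, ∀ M : ℕ, 2 ≤ M →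
    (((Finset.Ioc 0 M).filter fun n => Λ n ≠ 0).card : ℝ) ≤ C * (M / Real.log M) := by
  refine ⟨2 * Real.log 4 + 2 + 32 / Real.log 2, by positivity, fun M hM => ?_⟩
  have hM' : (2 : ℝ) ≤ M := by exact_mod_cast hM
  have hlog : 0 < Real.log M := Real.log_pos (by linarith)
  have hl2 : 0 < Real.log 2 := Real.log_pos one_lt_two
  set x : ℝ := (M : ℝ) with hx
  have hsq : 0 ≤ √x := Real.sqrt_nonneg x
  have hsqsq : √x * √x = x := Real.mul_self_sqrt (by linarith)
  have hlog1 : Real.log x ≤ 2 * √x := by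
    have h := Real.log_le_sub_one_of_pos (x := √x) (by positivity)
    rw [Real.log_sqrt (by linarith)] at h
    linarith
  have hlog2 : Real.log x ^ 2 ≤ 16 * √x := by
    set y := √(√x) with hy
    have hyy : y * y = √x := Real.mul_self_sqrt hsq
    have h := Real.log_le_sub_one_of_pos (x := y) (by positivity)
    rw [hy, Real.log_sqrt (by positivity), Real.log_sqrt (by linarith), ← hy] at h
    have h4 : Real.log x ≤ 4 * y := by linarith
    nlinarith [Real.sqrt_nonneg (√x)]
  set P := (Finset.Ioc 0 M).filter fun n => Λ n ≠ 0 with hP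
  have hsplit : P.card = (P.filter Nat.Prime).card + (P.filter fun n => ¬ n.Prime).card :=
    (Finset.card_filter_add_card_filter_not _).symm
  have h1 : ((P.filter Nat.Prime).card : ℝ) ≤ Real.log 4 * x / Real.log (√x) + √x := by
    refine le_trans ?_ (Chebyshev.pi_le_log4_mul_div (x := x) (by linarith))
    rw [hx, Nat.floor_natCast, Nat.primeCounting, Nat.primeCounting', Nat.count_eq_card_filter_range]
    refine Nat.cast_le.2 (Finset.card_le_card fun n hn => ?_)
    simp only [hP, Finset.mem_filter, Finset.mem_Ioc, Finset.mem_range] at hn ⊢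
    exact ⟨by omega, hn.2⟩
  have h2 : ((P.filter fun n => ¬ n.Prime).card : ℝ) * Real.log 2 ≤ 2 * √x * Real.log x := by
    refine le_trans ?_ (Chebyshev.psi_sub_theta_le (x := x) (by linarith))
    rw [Chebyshev.psi_sub_theta_eq_sum_not_prime, hx, Nat.floor_natCast]
    rw [← nsmul_eq_mul]
    refine (Finset.card_nsmul_le_sum (P.filter fun n => ¬ n.Prime) (fun n => Λ n) _ ?_).trans ?_
    · intro n hn
      simp only [hP, Finset.mem_filter, ArithmeticFunction.vonMangoldt_ne_zero_iff] at hn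
      rw [ArithmeticFunction.vonMangoldt_apply, if_pos hn.1.2]
      have := (Nat.minFac_prime hn.1.2.ne_one).two_le
      exact Real.log_le_log two_pos (by exact_mod_cast this)
    · refine Finset.sum_le_sum_of_subset_of_nonneg ?_ fun _ _ _ =>
        ArithmeticFunction.vonMangoldt_nonneg
      intro n hn
      simp only [hP, Finset.mem_filter] at hn ⊢
      exact ⟨hn.1.1, hn.2⟩
  have h3 : √x ≤ 2 * (x / Real.log x) := by
    rw [← mul_div_assoc, le_div_iff₀ hlog]
    nlinarith
  have h4 : ((P.filter fun n => ¬ n.Prime).card : ℝ) ≤ 32 / Real.log 2 * (x / Real.log x) := by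
    rw [← le_div_iff₀ hl2] at h2
    refine h2.trans ?_
    rw [div_mul_div_comm, div_le_div_iff₀ hl2 (by positivity)]
    have : √x * Real.log x * Real.log x ≤ 16 * x := by nlinarith
    nlinarith
  rw [hsplit, Nat.cast_add]
  rw [Real.log_sqrt (by linarith)] at h1
  have h5 : Real.log 4 * x / (Real.log x / 2) = 2 * Real.log 4 * (x / Real.log x) := by
    field_simp
  rw [h5] at h1
  linarith

/-! ### Lower bound for the Dirichlet sum. -/

theorem neg_mul_im_logZeta_summand (a σ t ξ L θ : ℝ) (hθ : θ = 1 ∨ θ = -1) :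
    -θ * ((a : ℂ) * (Complex.exp (-((σ : ℝ) + t * Complex.I) * ξ) *
      sineGaussianHat (θ * L) ξ)).im =
    a * Real.exp (-σ * ξ) * Real.sqrt (2 * Real.pi) *
      (Real.cos (t * ξ) * (Real.exp (-(ξ - L) ^ 2 / 2) - Real.exp (-(ξ + L) ^ 2 / 2)) / 2 +
        θ * Real.sin (t * ξ) * Real.exp (-ξ ^ 2 / 2)) := by
  have h1 : Complex.exp (-((σ : ℝ) + t * Complex.I) * ξ) = (Real.exp (-σ * ξ) : ℝ) *
      (Real.cos (t * ξ) - Real.sin (t * ξ) * Complex.I) := by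
    have : (-((σ : ℝ) + t * Complex.I) * ξ : ℂ) = ((-σ * ξ : ℝ) : ℂ) +
      ((-(t * ξ) : ℝ) : ℂ) * Complex.I := by push_cast; ring
    rw [this, Complex.exp_add, Complex.exp_mul_I, ← Complex.ofReal_cos, ← Complex.ofReal_sin,
      Real.cos_neg, Real.sin_neg, Complex.ofReal_exp]
    push_cast
    ring
  have h2 : sineGaussianHat (θ * L) ξ = (Real.sqrt (2 * Real.pi) : ℝ) *
      ((Real.exp (-ξ ^ 2 / 2) : ℝ) - ((θ * (Real.exp (-(ξ - L) ^ 2 / 2) -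
        Real.exp (-(ξ + L) ^ 2 / 2)) / 2 : ℝ) : ℂ) * Complex.I) := by
    unfold sineGaussianHat
    have h3 : ∀ z : ℂ, z / (2 * Complex.I) = -(z / 2) * Complex.I := by
      intro z
      rw [div_mul_eq_div_div, Complex.div_I, neg_mul]
    rw [h3]
    rcases hθ with rfl | rfl
    · push_cast; ring_nf
    · rw [show -1 * L = -L by ring, sub_neg_eq_add, ← sub_eq_add_neg]
      push_cast
      ring_nf
  have h4 : (a : ℂ) * (Complex.exp (-((σ : ℝ) + t * Complex.I) * ξ) *
      sineGaussianHat (θ * L) ξ) = ((a * Real.exp (-σ * ξ) * Real.sqrt (2 * Real.pi) : ℝ) : ℂ) *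
      ((Real.cos (t * ξ) * Real.exp (-ξ ^ 2 / 2) - Real.sin (t * ξ) *
        (θ * (Real.exp (-(ξ - L) ^ 2 / 2) - Real.exp (-(ξ + L) ^ 2 / 2)) / 2) : ℝ) -
      ((Real.sin (t * ξ) * Real.exp (-ξ ^ 2 / 2) + Real.cos (t * ξ) *
        (θ * (Real.exp (-(ξ - L) ^ 2 / 2) - Real.exp (-(ξ + L) ^ 2 / 2)) / 2) : ℝ) : ℂ) *
        Complex.I) := by
    rw [h1, h2]
    push_cast
    ring_nf
    rw [Complex.I_sq]
    ring
  rw [h4, Complex.im_ofReal_mul, Complex.sub_im, Complex.ofReal_im, Complex.im_ofReal_mul,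
    Complex.I_im]
  have hθ2 : θ * θ = 1 := by rcases hθ with rfl | rfl <;> norm_num
  linear_combination (a * Real.exp (-σ * ξ) * Real.sqrt (2 * Real.pi) * Real.cos (t * ξ) *
    (Real.exp (-(ξ - L) ^ 2 / 2) - Real.exp (-(ξ + L) ^ 2 / 2)) / 2) * hθ2

/-- Completing the square: with `v = ξ - L`, `3v/2 - v²/2 ≤ 9/8`. At `ξ = log n` the Gaussian is
thus traded for a convergent weight `1/n²`. -/
theorem exp_mul_exp_neg_sq_le {σ ξ L : ℝ} (hσ : 1 / 2 ≤ σ) (hξ : 0 ≤ ξ) :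
    Real.exp (-σ * ξ) * Real.exp (-(ξ - L) ^ 2 / 2) ≤
      Real.exp (9 / 8) * Real.exp (3 / 2 * L) * Real.exp (-2 * ξ) := by
  rw [← Real.exp_add, ← Real.exp_add, ← Real.exp_add]
  refine Real.exp_le_exp.2 ?_
  nlinarith [sq_nonneg (ξ - L - 3 / 2), mul_nonneg (sub_nonneg.2 hσ) hξ]

theorem exp_neg_two_mul_log {n : ℕ} (hn : 0 < n) :
    Real.exp (-2 * Real.log n) = 1 / (n : ℝ) ^ 2 := by
  have hn' : (0 : ℝ) < n := by exact_mod_cast hn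
  rw [neg_mul, Real.exp_neg, one_div, show (2 : ℝ) * Real.log n = ((2 : ℕ) : ℝ) * Real.log n by simp,
    Real.exp_nat_mul, Real.exp_log hn']

/-- Only the bump at `log n = L` matters: the bumps at `-L` and at `0` contribute `O(1/n²)`, whose
sum is bounded independently of `L`. -/
theorem sub_le_neg_mul_im_logZeta_summand {n : ℕ} (hn : 0 < n) {σ t L θ : ℝ} (hσ : 1 / 2 ≤ σ)
    (hL : 0 ≤ L) (hθ : θ = 1 ∨ θ = -1) :
    Real.sqrt (2 * Real.pi) / 2 * (logZetaCoeff n * (Real.cos (t * Real.log n) *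
      (Real.exp (-σ * Real.log n) * Real.exp (-(Real.log n - L) ^ 2 / 2)))) -
      2 * Real.sqrt (2 * Real.pi) * Real.exp (9 / 8) * (1 / (n : ℝ) ^ 2) ≤
    -θ * ((logZetaCoeff n : ℂ) * (Complex.exp (-((σ : ℝ) + t * Complex.I) * (Real.log n : ℝ)) *
      sineGaussianHat (θ * L) (Real.log n))).im := by
  rw [neg_mul_im_logZeta_summand _ _ _ _ _ _ hθ, ← exp_neg_two_mul_log hn]
  have hξ : 0 ≤ Real.log n := Real.log_natCast_nonneg n
  set ξ := Real.log n
  have h0 := exp_mul_exp_neg_sq_le (L := 0) hσ hξ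
  rw [sub_zero, mul_zero, Real.exp_zero, mul_one] at h0
  have h1 : Real.exp (-σ * ξ) * Real.exp (-(ξ + L) ^ 2 / 2) ≤
      Real.exp (9 / 8) * Real.exp (-2 * ξ) := by
    refine le_trans ?_ h0
    gcongr
    linarith
  have ha0 := logZetaCoeff_nonneg n
  have ha1 := logZetaCoeff_le_one n
  set a := logZetaCoeff n
  set r := Real.exp (-σ * ξ)
  set E := Real.exp (-(ξ - L) ^ 2 / 2)
  set F := Real.exp (-(ξ + L) ^ 2 / 2)
  set G := Real.exp (-ξ ^ 2 / 2)
  set B := Real.exp (9 / 8) * Real.exp (-2 * ξ) with hB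
  set q := Real.sqrt (2 * Real.pi)
  have hq : 0 ≤ q := Real.sqrt_nonneg _
  have hB0 : 0 ≤ B := by positivity
  have hrF : 0 ≤ r * F := by positivity
  have hrG : 0 ≤ r * G := by positivity
  have hc := Real.cos_le_one (t * ξ)
  have hs : -1 ≤ θ * Real.sin (t * ξ) := by
    have := Real.neg_one_le_sin (t * ξ)
    have := Real.sin_le_one (t * ξ)
    rcases hθ with rfl | rfl <;> linarith
  have k1 : a * (Real.cos (t * ξ) * (r * F)) ≤ B := by
    have : Real.cos (t * ξ) * (r * F) ≤ r * F := mul_le_of_le_one_left hrF hc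
    calc a * (Real.cos (t * ξ) * (r * F)) ≤ a * (r * F) := by gcongr
      _ ≤ r * F := mul_le_of_le_one_left hrF ha1
      _ ≤ B := h1
  have k2 : -B ≤ a * (θ * Real.sin (t * ξ) * (r * G)) := by
    have : -(r * G) ≤ θ * Real.sin (t * ξ) * (r * G) := by nlinarith
    have h2 : a * (-(r * G)) ≤ a * (θ * Real.sin (t * ξ) * (r * G)) := by gcongr
    have h3 : a * (r * G) ≤ r * G := mul_le_of_le_one_left hrG ha1
    linarith
  have k3 := mul_le_mul_of_nonneg_left k1 hq
  have k4 := mul_le_mul_of_nonneg_left k2 hq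
  have k5 : 0 ≤ q * B := by positivity
  have e : 2 * q * Real.exp (9 / 8) * Real.exp (-2 * ξ) = 2 * (q * B) := by rw [hB]; ring
  rw [e]
  linarith

-- For `N/24 < n ≤ N` the Gaussian weight is bounded below, and the hypothesis on `η` costs at most
-- a factor `2` in `n^{-1/2-η}`.
open scoped ArithmeticFunction.vonMangoldt in
theorem exp_half_log_div_log_le_sum {N : ℕ} (hN : 100 ≤ N) {η : ℝ} (hη : 0 ≤ η)
    (hηN : η * Real.log N ≤ Real.log 2) :
    Real.exp (-Real.log 24 ^ 2 / 2) / 8 * (Real.exp (Real.log N / 2) / Real.log N) ≤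
    ∑ n ∈ Finset.Ioc (N / 24) N, logZetaCoeff n *
      (Real.exp (-(1 / 2 + η) * Real.log n) * Real.exp (-(Real.log n - Real.log N) ^ 2 / 2)) := by
  have hN' : (100 : ℝ) ≤ N := by exact_mod_cast hN
  have hL : 0 < Real.log N := Real.log_pos (by linarith)
  have hterm : ∀ n ∈ Finset.Ioc (N / 24) N,
      Λ n * (Real.exp (-Real.log N / 2) / 2 * Real.exp (-Real.log 24 ^ 2 / 2) / Real.log N) ≤
      logZetaCoeff n * (Real.exp (-(1 / 2 + η) * Real.log n) *
        Real.exp (-(Real.log n - Real.log N) ^ 2 / 2)) := by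
    intro n hn
    rw [Finset.mem_Ioc] at hn
    have hn24 : N < 24 * n := by omega
    have hn1 : 1 < n := by omega
    have hn1' : (1 : ℝ) < n := by exact_mod_cast hn1
    have hnN : (n : ℝ) ≤ N := by exact_mod_cast hn.2
    have hl0 : 0 < Real.log n := Real.log_pos hn1'
    have hlN : Real.log n ≤ Real.log N := Real.log_le_log (by linarith) hnN
    have hl24 : Real.log N ≤ Real.log 24 + Real.log n := by
      rw [← Real.log_mul (by norm_num) (by linarith)]
      exact Real.log_le_log (by linarith) (by exact_mod_cast hn24.le)
    have h1 : Real.exp (-Real.log N / 2) / 2 ≤ Real.exp (-(1 / 2 + η) * Real.log n) := by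
      rw [← Real.exp_log (show (0 : ℝ) < 2 by norm_num), ← Real.exp_sub,
        Real.exp_log (show (0 : ℝ) < 2 by norm_num)]
      refine Real.exp_le_exp.2 ?_
      nlinarith
    have h2 : Real.exp (-Real.log 24 ^ 2 / 2) ≤ Real.exp (-(Real.log n - Real.log N) ^ 2 / 2) := by
      refine Real.exp_le_exp.2 ?_
      nlinarith
    have h3 : Λ n / Real.log N ≤ logZetaCoeff n :=
      div_le_div_of_nonneg_left ArithmeticFunction.vonMangoldt_nonneg hl0 hlN
    calc _ = Λ n / Real.log N * (Real.exp (-Real.log N / 2) / 2 *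
          Real.exp (-Real.log 24 ^ 2 / 2)) := by ring
      _ ≤ _ := mul_le_mul h3 (mul_le_mul h1 h2 (by positivity) (by positivity)) (by positivity)
          (logZetaCoeff_nonneg n)
  refine le_trans ?_ (Finset.sum_le_sum hterm)
  rw [← Finset.sum_mul]
  refine le_trans (le_of_eq ?_) (mul_le_mul_of_nonneg_right (div_four_le_sum_vonMangoldt hN)
    (by positivity))
  have : (N : ℝ) * Real.exp (-Real.log N / 2) = Real.exp (Real.log N / 2) := by
    nth_rewrite 1 [← Real.exp_log (show (0 : ℝ) < N by linarith)]
    rw [← Real.exp_add]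
    congr 1
    ring
  rw [← this]
  ring

open scoped ArithmeticFunction.vonMangoldt in
theorem sum_tail_le {N R : ℕ} (hN : 100 ≤ N) (hR : 1 ≤ R) {σ : ℝ} (hσ : 1 / 2 ≤ σ) (K : ℕ)
    (hK : R * N ≤ K) :
    ∑ n ∈ Finset.Ioc (R * N) K, logZetaCoeff n *
      (Real.exp (-σ * Real.log n) * Real.exp (-(Real.log n - Real.log N) ^ 2 / 2)) ≤
    12 * Real.exp (9 / 8) / R * (Real.exp (Real.log N / 2) / Real.log N) := by
  have hN' : (100 : ℝ) ≤ N := by exact_mod_cast hN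
  have hR' : (1 : ℝ) ≤ R := by exact_mod_cast hR
  have hL : 0 < Real.log N := Real.log_pos (by linarith)
  have hterm : ∀ n ∈ Finset.Ioc (R * N) K, logZetaCoeff n *
      (Real.exp (-σ * Real.log n) * Real.exp (-(Real.log n - Real.log N) ^ 2 / 2)) ≤
      Real.exp (9 / 8) * Real.exp (3 / 2 * Real.log N) / Real.log N * (Λ n / (n : ℝ) ^ 2) := by
    intro n hn
    rw [Finset.mem_Ioc] at hn
    have hNn : N ≤ n := (Nat.le_mul_of_pos_left N (by omega)).trans hn.1.le
    have hNn' : (N : ℝ) ≤ n := by exact_mod_cast hNn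
    have h1 : logZetaCoeff n ≤ Λ n / Real.log N :=
      div_le_div_of_nonneg_left ArithmeticFunction.vonMangoldt_nonneg hL
        (Real.log_le_log (by linarith) hNn')
    have h2 := exp_mul_exp_neg_sq_le (L := Real.log N) hσ (Real.log_natCast_nonneg n)
    rw [exp_neg_two_mul_log (by omega)] at h2
    calc _ ≤ Λ n / Real.log N * _ := mul_le_mul h1 h2 (by positivity)
          (div_nonneg ArithmeticFunction.vonMangoldt_nonneg hL.le)
      _ = _ := by ring
  refine (Finset.sum_le_sum hterm).trans ?_
  rw [← Finset.mul_sum]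
  have hRN : 1 ≤ R * N := Nat.mul_pos (by omega) (by omega)
  refine (mul_le_mul_of_nonneg_left (sum_vonMangoldt_div_sq_le hRN K hK)
    (by positivity)).trans (le_of_eq ?_)
  have : Real.exp (3 / 2 * Real.log N) = N * Real.exp (Real.log N / 2) := by
    nth_rewrite 2 [← Real.exp_log (show (0 : ℝ) < N by linarith)]
    rw [← Real.exp_add]
    congr 1
    ring
  rw [this]
  push_cast
  field_simp

-- The cosines are controlled only up to `RN`; beyond it they are bounded trivially, and the factor
-- `1/R` of `sum_tail_le` makes that tail smaller than the main term.
open scoped ArithmeticFunction.vonMangoldt in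
theorem exists_lower_bound_im_sum : ∃ R : ℕ, 1 ≤ R ∧ ∃ c > 0, ∃ B : ℝ, 0 ≤ B ∧ ∀ N : ℕ, 100 ≤ N →
    ∀ θ : ℝ, θ = 1 ∨ θ = -1 → ∀ η t : ℝ, 0 ≤ η → η * Real.log N ≤ Real.log 2 →
    (∀ n ∈ (Finset.Ioc 0 (R * N)).filter fun n => Λ n ≠ 0, 1 / 2 ≤ Real.cos (t * Real.log n)) →
    Summable (fun n : ℕ => (logZetaCoeff n : ℂ) *
      (Complex.exp (-((1 / 2 + η : ℝ) + t * Complex.I) * (Real.log n : ℝ)) *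
        sineGaussianHat (θ * Real.log N) (Real.log n))) →
    c * (Real.exp (Real.log N / 2) / Real.log N) - B ≤
      -θ * (∑' n : ℕ, (logZetaCoeff n : ℂ) *
        (Complex.exp (-((1 / 2 + η : ℝ) + t * Complex.I) * (Real.log n : ℝ)) *
          sineGaussianHat (θ * Real.log N) (Real.log n))).im := by
  set e₀ := Real.exp (-Real.log 24 ^ 2 / 2) with he₀
  have he₀p : 0 < e₀ := Real.exp_pos _
  set q := Real.sqrt (2 * Real.pi) with hq
  have hq0 : 0 < q := by positivity
  -- `384 = 12 · 32`: the tail is then at most `e₀/32 · Q`, half of the main term `e₀/16 · Q`.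
  obtain ⟨R, hR⟩ := exists_nat_ge (384 * Real.exp (9 / 8) / e₀ + 1)
  have hR1' : (1 : ℝ) ≤ R := le_trans (by have : 0 < 384 * Real.exp (9 / 8) / e₀ := by positivity
                                          linarith) hR
  have hR1 : 1 ≤ R := by exact_mod_cast hR1'
  refine ⟨R, hR1, q / 2 * (e₀ / 32), by positivity,
    2 * q * Real.exp (9 / 8) * ∑' n : ℕ, 1 / (n : ℝ) ^ 2, ?_, ?_⟩
  · exact mul_nonneg (by positivity) (tsum_nonneg fun n => by positivity)
  intro N hN θ hθ η t hη hηN hcos hsum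
  have hN' : (100 : ℝ) ≤ N := by exact_mod_cast hN
  have hL : 0 < Real.log N := Real.log_pos (by linarith)
  have hσ : (1 / 2 : ℝ) ≤ 1 / 2 + η := by linarith
  set T : ℕ → ℂ := fun n => (logZetaCoeff n : ℂ) *
        (Complex.exp (-((1 / 2 + η : ℝ) + t * Complex.I) * (Real.log n : ℝ)) *
          sineGaussianHat (θ * Real.log N) (Real.log n)) with hT
  set w : ℕ → ℝ := fun n => Real.exp (-(1 / 2 + η) * Real.log n) *
    Real.exp (-(Real.log n - Real.log N) ^ 2 / 2) with hw
  have hw0 : ∀ n, 0 ≤ w n := fun n => by positivity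
  set Q := Real.exp (Real.log N / 2) / Real.log N with hQ
  have hQ0 : 0 < Q := by positivity
  have hs2 : Summable fun n : ℕ => 1 / (n : ℝ) ^ 2 := Real.summable_one_div_nat_pow.2 one_lt_two
  have hlim : Tendsto (fun K : ℕ => -θ * (∑ n ∈ Finset.range (K + 1), T n).im) atTop
      (𝓝 (-θ * (∑' n, T n).im)) :=
    ((Complex.continuous_im.tendsto _).comp
      (hsum.hasSum.tendsto_sum_nat.comp (tendsto_add_atTop_nat 1))).const_mul _
  refine ge_of_tendsto hlim ?_
  filter_upwards [eventually_ge_atTop (R * N)] with K hK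
  have hNR : N ≤ R * N := Nat.le_mul_of_pos_left N (by omega)
  have hT0 : T 0 = 0 := by simp [hT, logZetaCoeff_zero]
  have hrange : ∑ n ∈ Finset.range (K + 1), T n = ∑ n ∈ Finset.Ioc 0 K, T n := by
    have : Finset.range (K + 1) = insert 0 (Finset.Ioc 0 K) := by
      ext n
      simp only [Finset.mem_range, Finset.mem_insert, Finset.mem_Ioc]
      omega
    rw [this, Finset.sum_insert (by simp), hT0, zero_add]
  rw [hrange, Complex.im_sum, Finset.mul_sum]
  have hle : ∑ n ∈ Finset.Ioc 0 K, (q / 2 * (logZetaCoeff n * (Real.cos (t * Real.log n) * w n)) -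
      2 * q * Real.exp (9 / 8) * (1 / (n : ℝ) ^ 2)) ≤ ∑ n ∈ Finset.Ioc 0 K, -θ * (T n).im :=
    Finset.sum_le_sum fun n hn =>
      sub_le_neg_mul_im_logZeta_summand (Finset.mem_Ioc.1 hn).1 hσ hL.le hθ
  refine le_trans ?_ hle
  rw [Finset.sum_sub_distrib, ← Finset.mul_sum, ← Finset.mul_sum]
  have h1 : ∑ n ∈ Finset.Ioc 0 K, 1 / (n : ℝ) ^ 2 ≤ ∑' n : ℕ, 1 / (n : ℝ) ^ 2 :=
    hs2.sum_le_tsum _ fun _ _ => by positivity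
  have haw : ∀ n, 0 ≤ logZetaCoeff n * w n := fun n => mul_nonneg (logZetaCoeff_nonneg n) (hw0 n)
  have h2 : e₀ / 16 * Q ≤ ∑ n ∈ Finset.Ioc 0 (R * N),
      logZetaCoeff n * (Real.cos (t * Real.log n) * w n) := by
    have h3 : ∑ n ∈ Finset.Ioc 0 (R * N), 1 / 2 * (logZetaCoeff n * w n) ≤
        ∑ n ∈ Finset.Ioc 0 (R * N), logZetaCoeff n * (Real.cos (t * Real.log n) * w n) := by
      refine Finset.sum_le_sum fun n hn => ?_
      by_cases hΛ : Λ n = 0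
      · have : logZetaCoeff n = 0 := by rw [logZetaCoeff, hΛ, zero_div]
        simp [this]
      · have h4 := hcos n (Finset.mem_filter.2 ⟨hn, hΛ⟩)
        have h5 := mul_le_mul_of_nonneg_right h4 (haw n)
        linarith
    refine le_trans ?_ h3
    rw [← Finset.mul_sum]
    have h6 : ∑ n ∈ Finset.Ioc (N / 24) N, logZetaCoeff n * w n ≤
        ∑ n ∈ Finset.Ioc 0 (R * N), logZetaCoeff n * w n :=
      Finset.sum_le_sum_of_subset_of_nonneg (Finset.Ioc_subset_Ioc (Nat.zero_le _) hNR)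
        fun n _ _ => haw n
    have h7 := exp_half_log_div_log_le_sum hN hη hηN
    linarith
  have h3 : -(e₀ / 32 * Q) ≤ ∑ n ∈ Finset.Ioc (R * N) K,
      logZetaCoeff n * (Real.cos (t * Real.log n) * w n) := by
    have h4 : ∑ n ∈ Finset.Ioc (R * N) K, -(logZetaCoeff n * w n) ≤
        ∑ n ∈ Finset.Ioc (R * N) K, logZetaCoeff n * (Real.cos (t * Real.log n) * w n) := by
      refine Finset.sum_le_sum fun n _ => ?_
      have h5 := mul_le_mul_of_nonneg_right (Real.neg_one_le_cos (t * Real.log n)) (haw n)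
      linarith
    refine le_trans ?_ h4
    rw [Finset.sum_neg_distrib, neg_le_neg_iff]
    refine (sum_tail_le hN hR1 hσ K hK).trans ?_
    refine mul_le_mul_of_nonneg_right ?_ hQ0.le
    rw [div_le_iff₀ (by linarith)]
    have h6 : 384 * Real.exp (9 / 8) / e₀ ≤ R := by linarith
    rw [div_le_iff₀ he₀p] at h6
    linarith
  rw [← Finset.sum_Ioc_consecutive _ (Nat.zero_le _) hK]
  have h4 := mul_le_mul_of_nonneg_left (add_le_add h2 h3) (by positivity : 0 ≤ q / 2)
  have h5 := mul_le_mul_of_nonneg_left h1 (by positivity : 0 ≤ 2 * q * Real.exp (9 / 8))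
  linarith

/-! ### Passing to the critical line. -/

theorem countable_setOf_isZetaOrdinate : {t : ℝ | IsZetaOrdinate t}.Countable := by
  have h : riemannZetaZeros.Countable := by
    have := isDiscrete_riemannZetaZeros.to_subtype
    exact countable_of_Lindelof_of_discrete
  refine (h.image Complex.im).mono ?_
  rintro t ⟨s, hs, rfl⟩
  exact ⟨s, hs, rfl⟩

/-- The kernel `e^{-x²/2} (1 + sin lx)` as a real function. -/
noncomputable def sineGaussianReal (l x : ℝ) : ℝ := Real.exp (-x ^ 2 / 2) * (1 + Real.sin (l * x))

theorem continuous_sineGaussianReal (l : ℝ) : Continuous (sineGaussianReal l) := by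
  unfold sineGaussianReal
  fun_prop

theorem sineGaussianReal_nonneg (l x : ℝ) : 0 ≤ sineGaussianReal l x :=
  mul_nonneg (Real.exp_pos _).le (by linarith [Real.neg_one_le_sin (l * x)])

theorem sineGaussianReal_le (l x : ℝ) : sineGaussianReal l x ≤ 2 * Real.exp (-x ^ 2 / 2) := by
  unfold sineGaussianReal
  rw [mul_comm]
  gcongr
  linarith [Real.sin_le_one (l * x)]

theorem integral_sineGaussianReal_le (l : ℝ) {a b : ℝ} (hab : a ≤ b) :
    ∫ x in a..b, sineGaussianReal l x ≤ 2 * Real.sqrt (2 * Real.pi) := by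
  have hi := (integrable_exp_neg_sq_div 2 two_pos).const_mul 2
  calc ∫ x in a..b, sineGaussianReal l x ≤ ∫ x in a..b, 2 * Real.exp (-x ^ 2 / 2) :=
        intervalIntegral.integral_mono_on hab
          (continuous_sineGaussianReal l).continuousOn.intervalIntegrable hi.intervalIntegrable
          fun x _ => sineGaussianReal_le l x
    _ ≤ ∫ x, 2 * Real.exp (-x ^ 2 / 2) := by
        rw [intervalIntegral.integral_of_le hab]
        exact MeasureTheory.setIntegral_le_integral hi (Eventually.of_forall fun x => by positivity)
    _ = 2 * Real.sqrt (2 * Real.pi) := by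
        rw [MeasureTheory.integral_const_mul]
        congr 1
        have := integral_gaussian (1 / 2)
        rw [show Real.pi / (1 / 2) = 2 * Real.pi by ring] at this
        rw [← this]
        congr 1
        ext x
        congr 1
        ring

theorem IsLogZeta.continuousOn_line {f : ℂ → ℂ} (hf : IsLogZeta f) {t a b η : ℝ} (hη : 0 < η)
    (hta : 0 < t + a) (hab : a ≤ b) :
    ContinuousOn (fun x : ℝ => f ((1 / 2 + η : ℝ) + (t + x : ℝ) * Complex.I)) (uIcc a b) := by
  rw [uIcc_of_le hab]
  refine hf.differentiableOn.continuousOn.comp (by fun_prop) fun x hx => ?_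
  constructor
  · simp [hη]
  · have := hx.1
    simp
    linarith

theorem IsLogZeta.im_integral_mul_sineGaussian {f : ℂ → ℂ} (hf : IsLogZeta f) {t a b η : ℝ}
    (hη : 0 < η) (hta : 0 < t + a) (hab : a ≤ b) (l : ℝ) :
    (∫ x in a..b, f ((1 / 2 + η : ℝ) + (t + x : ℝ) * Complex.I) * sineGaussian l x).im =
      ∫ x in a..b, (f ((1 / 2 + η : ℝ) + (t + x : ℝ) * Complex.I)).im * sineGaussianReal l x := by
  have hi : IntervalIntegrable (fun x : ℝ => f ((1 / 2 + η : ℝ) + (t + x : ℝ) * Complex.I) *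
      sineGaussian l x) MeasureTheory.volume a b :=
    ((hf.continuousOn_line hη hta hab).mul
      ((continuous_sineGaussian l).comp Complex.continuous_ofReal).continuousOn).intervalIntegrable
  have h := Complex.imCLM.intervalIntegral_comp_comm hi
  rw [Complex.imCLM_apply] at h
  rw [← h]
  refine intervalIntegral.integral_congr fun x _ => ?_
  simp only [Complex.imCLM_apply]
  rw [sineGaussian_ofReal, Complex.im_mul_ofReal, sineGaussianReal]

theorem IsLogZeta.le_mul_integral_of_zetaS_le {f : ℂ → ℂ} (hf : IsLogZeta f)
    {t a b l σ B V η₀ : ℝ} (hta : 0 < t + a) (hab : a ≤ b) (hη₀ : 0 < η₀)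
    (hS : ∀ x ∈ Icc a b, ¬ IsZetaOrdinate (t + x) → σ * (Real.pi * zetaS (t + x)) ≤ B)
    (hV : ∀ η ∈ Ioo 0 η₀, V ≤ σ * ∫ x in a..b,
      (f ((1 / 2 + η : ℝ) + (t + x : ℝ) * Complex.I)).im * sineGaussianReal l x) :
    V ≤ B * ∫ x in a..b, sineGaussianReal l x := by
  obtain ⟨δ, hδ, C, hC⟩ := hf.exists_im_bound (A := t + a) (B := t + b) hta
  set g : ℝ → ℝ → ℝ := fun η x => (f ((1 / 2 + η : ℝ) + (t + x : ℝ) * Complex.I)).im with hg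
  -- Only the excess over `B` is followed as `η → 0`: it is dominated by `hC` and tends to `0` off
  -- the ordinates.
  set h : ℝ → ℝ → ℝ := fun η x => max (σ * g η x - B) 0 * sineGaussianReal l x with hh
  have hgc : ∀ η, 0 < η → ContinuousOn (g η) (uIcc a b) := fun η hη =>
    Complex.continuous_im.comp_continuousOn (hf.continuousOn_line hη hta hab)
  have hK := continuous_sineGaussianReal l
  have hhc : ∀ η, 0 < η → ContinuousOn (h η) (uIcc a b) := fun η hη =>
    (((continuousOn_const.mul (hgc η hη)).sub continuousOn_const).sup continuousOn_const).mul
      hK.continuousOn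
  have hlim : Tendsto (fun η => ∫ x in a..b, h η x) (𝓝[>] 0) (𝓝 (∫ _ in a..b, (0 : ℝ))) := by
    refine intervalIntegral.tendsto_integral_filter_of_dominated_convergence
      (fun _ => (|σ| * C + |B|) * 2) ?_ ?_ (by simp) ?_
    · filter_upwards [self_mem_nhdsWithin] with η hη
      exact ((hhc η hη).mono uIoc_subset_uIcc).aestronglyMeasurable measurableSet_uIoc
    · filter_upwards [Ioo_mem_nhdsGT hδ] with η hη
      refine Eventually.of_forall fun x hx => ?_
      rw [uIoc_of_le hab] at hx
      have h1 : |g η x| ≤ C := hC η hη (t + x) ⟨by linarith [hx.1], by linarith [hx.2]⟩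
      have h2 : sineGaussianReal l x ≤ 2 := (sineGaussianReal_le l x).trans (by
        have : Real.exp (-x ^ 2 / 2) ≤ 1 := Real.exp_le_one_iff.2 (by nlinarith [sq_nonneg x])
        linarith)
      have h3 : σ * g η x - B ≤ |σ| * C + |B| := by
        have e1 : σ * g η x ≤ |σ| * C := (le_abs_self _).trans (by rw [abs_mul]; gcongr)
        linarith [neg_le_abs B]
      have h4 : 0 ≤ |σ| * C + |B| := by
        have := (abs_nonneg _).trans h1
        positivity
      rw [Real.norm_eq_abs, abs_of_nonneg (mul_nonneg (le_max_right _ _)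
        (sineGaussianReal_nonneg l x))]
      exact mul_le_mul (max_le h3 h4) h2 (sineGaussianReal_nonneg l x) h4
    · have hnull : ∀ᵐ x : ℝ, ¬ IsZetaOrdinate (t + x) := by
        have h1 : {x : ℝ | IsZetaOrdinate (t + x)}.Countable :=
          countable_setOf_isZetaOrdinate.preimage (add_right_injective t)
        exact MeasureTheory.measure_eq_zero_iff_ae_notMem.1 (h1.measure_zero _)
      filter_upwards [hnull] with x hx hxI
      rw [uIoc_of_le hab] at hxI
      have htx : 0 < t + x := by linarith [hxI.1]
      have h1 := hf.tendsto_im htx hx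
      have h2 : Tendsto (fun η : ℝ => 1 / 2 + η) (𝓝[>] 0) (𝓝[>] (1 / 2)) := by
        refine tendsto_nhdsWithin_iff.2 ⟨?_, ?_⟩
        · refine Tendsto.mono_left ?_ nhdsWithin_le_nhds
          have : Continuous fun η : ℝ => 1 / 2 + η := by fun_prop
          simpa using this.tendsto 0
        · filter_upwards [self_mem_nhdsWithin] with η hη
          have : 0 < η := hη
          simp only [mem_Ioi]
          linarith
      have h3 : Tendsto (fun η => g η x) (𝓝[>] 0) (𝓝 (Real.pi * zetaS (t + x))) := h1.comp h2
      have h4 := (((h3.const_mul σ).sub_const B).max (tendsto_const_nhds (x := (0 : ℝ)))).mul_const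
        (sineGaussianReal l x)
      have h5 : max (σ * (Real.pi * zetaS (t + x)) - B) 0 = 0 :=
        max_eq_right (by linarith [hS x ⟨hxI.1.le, hxI.2⟩ hx])
      rw [h5, zero_mul] at h4
      exact h4
  rw [intervalIntegral.integral_zero] at hlim
  have hlim2 := hlim.const_add (B * ∫ x in a..b, sineGaussianReal l x)
  rw [add_zero] at hlim2
  refine ge_of_tendsto hlim2 ?_
  filter_upwards [Ioo_mem_nhdsGT hη₀] with η hη
  refine (hV η hη).trans ?_
  rw [← intervalIntegral.integral_const_mul, ← intervalIntegral.integral_const_mul,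
    ← intervalIntegral.integral_add (hK.const_mul B).continuousOn.intervalIntegrable
      (hhc η hη.1).intervalIntegrable]
  refine intervalIntegral.integral_mono_on hab
    (continuousOn_const.mul ((hgc η hη.1).mul hK.continuousOn)).intervalIntegrable
    ((continuous_const.mul hK).continuousOn.add (hhc η hη.1)).intervalIntegrable fun x _ => ?_
  have h1 : σ * g η x ≤ B + max (σ * g η x - B) 0 := by
    linarith [le_max_left (σ * g η x - B) 0]
  have h2 := mul_le_mul_of_nonneg_right h1 (sineGaussianReal_nonneg l x)
  simp only [hh]
  linarith

/-! ### Choice of parameters and conclusion. -/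

/-- Such points recur with period `2π/|l| ≤ 2π < 7`. -/
theorem exists_sin_mul_eq_neg_one {l : ℝ} (hl : 1 ≤ |l|) (U : ℝ) :
    ∃ b, U ≤ b ∧ b ≤ U + 7 ∧ Real.sin (l * b) = -1 := by
  have hpi := Real.pi_pos
  have hpi4 := Real.pi_lt_d2
  have hl0 : 0 < |l| := by linarith
  have key : ∀ c : ℝ, ∃ m : ℤ, U ≤ (c + m * (2 * Real.pi)) / |l| ∧
      (c + m * (2 * Real.pi)) / |l| ≤ U + 7 := by
    intro c
    refine ⟨⌈(U * |l| - c) / (2 * Real.pi)⌉, ?_, ?_⟩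
    · rw [le_div_iff₀ hl0]
      have := Int.le_ceil ((U * |l| - c) / (2 * Real.pi))
      rw [div_le_iff₀ (by positivity)] at this
      linarith
    · rw [div_le_iff₀ hl0]
      have := (Int.ceil_lt_add_one ((U * |l| - c) / (2 * Real.pi))).le
      rw [← sub_le_iff_le_add, le_div_iff₀ (by positivity)] at this
      nlinarith
  rcases le_total 0 l with h | h
  · obtain ⟨m, h1, h2⟩ := key (-(Real.pi / 2))
    refine ⟨_, h1, h2, ?_⟩
    rw [abs_of_nonneg h] at hl0 ⊢
    rw [mul_div_cancel₀ _ hl0.ne', Real.sin_add_int_mul_two_pi, Real.sin_neg, Real.sin_pi_div_two]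
  · obtain ⟨m, h1, h2⟩ := key (Real.pi / 2)
    refine ⟨_, h1, h2, ?_⟩
    rw [abs_of_nonpos h] at hl0 ⊢
    rw [div_neg, mul_neg, mul_div_cancel₀ _ (by linarith), Real.sin_neg,
      Real.sin_add_int_mul_two_pi, Real.sin_pi_div_two]

theorem pow_six_mul_exp_neg_le (Y : ℝ) : Y ^ 6 * Real.exp (-Y ^ 2 / 64) ≤ 6 * 64 ^ 3 := by
  have h := Real.pow_div_factorial_le_exp (Y ^ 2 / 64) (by positivity) 3
  have e : Real.exp (-Y ^ 2 / 64) = (Real.exp (Y ^ 2 / 64))⁻¹ := by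
    rw [← Real.exp_neg]; congr 1; ring
  rw [e, ← div_eq_mul_inv, div_le_iff₀ (Real.exp_pos _)]
  have h3 : ((3).factorial : ℝ) = 6 := by norm_num [Nat.factorial]
  rw [h3] at h
  nlinarith

theorem one_add_log_two_le_log_six : 1 + Real.log 2 ≤ Real.log 6 := by
  have h3 : 1 ≤ Real.log 3 := by
    rw [Real.le_log_iff_exp_le (by norm_num)]
    have := Real.exp_one_lt_d9
    linarith
  have : Real.log 6 = Real.log 2 + Real.log 3 := by
    rw [← Real.log_mul (by norm_num) (by norm_num)]; norm_num
  linarith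

theorem log_six_le_two : Real.log 6 ≤ 2 := by
  rw [Real.log_le_iff_le_exp (by norm_num)]
  have h1 := Real.exp_one_gt_d9
  have h2 : Real.exp 2 = Real.exp 1 * Real.exp 1 := by rw [← Real.exp_add]; norm_num
  nlinarith

theorem log_pow_four_le {w : ℕ} (hw : 10 ≤ w) : Real.log ((w ^ 4 : ℕ) : ℝ) ≤ 4 * w := by
  have hw' : (10 : ℝ) ≤ w := by exact_mod_cast hw
  rw [Nat.cast_pow, Real.log_pow]
  have := Real.log_le_sub_one_of_pos (show (0 : ℝ) < w by linarith)
  push_cast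
  linarith

theorem pow_four_le_six_pow {w m : ℕ} (hw : 10 ≤ w)
    (hm : ((w ^ 4 : ℕ) : ℝ) / Real.log ((w ^ 4 : ℕ) : ℝ) ≤ m) :
    ((w ^ 4 : ℕ) : ℝ) ≤ 6 ^ m := by
  have hw' : (10 : ℝ) ≤ w := by exact_mod_cast hw
  have hL4 := log_pow_four_le hw
  have hcast : ((w ^ 4 : ℕ) : ℝ) = (w : ℝ) ^ 4 := by push_cast; rfl
  have hN1 : (1 : ℝ) < ((w ^ 4 : ℕ) : ℝ) := by rw [hcast]; exact one_lt_pow₀ (by linarith) (by norm_num)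
  have hL : 0 < Real.log ((w ^ 4 : ℕ) : ℝ) := Real.log_pos hN1
  have h1 : Real.log ((w ^ 4 : ℕ) : ℝ) ≤ m := by
    refine le_trans ?_ hm
    rw [le_div_iff₀ hL, hcast]
    rw [hcast] at hL4 hL
    have h2 : Real.log ((w : ℝ) ^ 4) * Real.log ((w : ℝ) ^ 4) ≤ (4 * w) * (4 * w) := by gcongr
    have h3 : (4 * w : ℝ) * (4 * w) ≤ (w : ℝ) ^ 4 := by
      have : (16 : ℝ) ≤ w ^ 2 := by nlinarith
      nlinarith [sq_nonneg (w : ℝ)]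
    linarith
  have h6 := one_add_log_two_le_log_six
  have hl2 := Real.log_pos one_lt_two
  rw [← Real.log_le_log_iff (by linarith) (by positivity), Real.log_pow]
  nlinarith [(Nat.cast_nonneg m : (0 : ℝ) ≤ m)]

/-- With `N = w⁴`: `log τ` is at most a constant times `N / log N`, and `log log τ ≥ (log N)/2`
because `log τ ≥ w² = √N`. -/
theorem sqrt_log_div_log_log_le {w m : ℕ} (hw : 10 ≤ w) {D τ : ℝ} (hD : 1 ≤ D)
    (hm : ((w ^ 4 : ℕ) : ℝ) / Real.log ((w ^ 4 : ℕ) : ℝ) ≤ m)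
    (hm' : (m : ℝ) ≤ 2 * D * (((w ^ 4 : ℕ) : ℝ) / Real.log ((w ^ 4 : ℕ) : ℝ)))
    (h1 : 6 ^ m / 2 ≤ τ) (h2 : τ ≤ 2 * (6 ^ m) ^ 2) :
    Real.sqrt (Real.log τ / Real.log (Real.log τ)) ≤
      Real.sqrt (24 * D) * ((w : ℝ) ^ 2 / Real.log ((w ^ 4 : ℕ) : ℝ)) := by
  have hw' : (10 : ℝ) ≤ w := by exact_mod_cast hw
  have hL4 := log_pow_four_le hw
  have hcast : ((w ^ 4 : ℕ) : ℝ) = (w : ℝ) ^ 4 := by push_cast; rfl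
  have hN1 : (1 : ℝ) < ((w ^ 4 : ℕ) : ℝ) := by rw [hcast]; exact one_lt_pow₀ (by linarith) (by norm_num)
  have hL : 0 < Real.log ((w ^ 4 : ℕ) : ℝ) := Real.log_pos hN1
  have hL2 : Real.log ((w ^ 4 : ℕ) : ℝ) = 4 * Real.log w := by
    rw [hcast, Real.log_pow]; norm_num
  set L := Real.log ((w ^ 4 : ℕ) : ℝ)
  set z := ((w ^ 4 : ℕ) : ℝ) / L with hz
  have hzw : (w : ℝ) ^ 2 ≤ z := by
    rw [hz, le_div_iff₀ hL, hcast]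
    have : (w : ℝ) ^ 2 * L ≤ (w : ℝ) ^ 2 * (4 * w) := by gcongr
    nlinarith [pow_pos (show (0 : ℝ) < w by linarith) 3]
  have hm1 : (1 : ℝ) ≤ m := by nlinarith
  have h6 := one_add_log_two_le_log_six
  have h62 := log_six_le_two
  have hl2 := Real.log_pos one_lt_two
  have hY : (0 : ℝ) < 6 ^ m := by positivity
  have hτ : 0 < τ := by linarith [half_pos hY]
  have hlow : (w : ℝ) ^ 2 ≤ Real.log τ := by
    have h3 := Real.log_le_log (half_pos hY) h1
    rw [Real.log_div hY.ne' two_ne_zero, Real.log_pow] at h3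
    nlinarith
  have hupp : Real.log τ ≤ 12 * D * z := by
    have h3 := Real.log_le_log hτ h2
    rw [Real.log_mul two_ne_zero (by positivity), Real.log_pow, Real.log_pow] at h3
    push_cast at h3
    nlinarith
  have hll : L / 2 ≤ Real.log (Real.log τ) := by
    have h3 := Real.log_le_log (by positivity) hlow
    rw [Real.log_pow] at h3
    push_cast at h3
    linarith
  have hw2 : 0 ≤ (w : ℝ) ^ 2 / L := by positivity
  rw [← Real.sqrt_sq hw2, ← Real.sqrt_mul (by positivity)]
  refine Real.sqrt_le_sqrt ?_
  calc Real.log τ / Real.log (Real.log τ) ≤ (12 * D * z) / (L / 2) := by gcongr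
    _ = 24 * D * ((w : ℝ) ^ 2 / L) ^ 2 := by
        rw [hz, hcast]
        field_simp
        ring

open scoped ArithmeticFunction.vonMangoldt in
theorem exists_zetaS_large (hRH : RiemannHypothesis) : ∃ c > 0, ∀ θ : ℝ, θ = 1 ∨ θ = -1 →
    ∀ T : ℝ, ∃ τ, T ≤ τ ∧
      c * Real.sqrt (Real.log τ / Real.log (Real.log τ)) ≤ -θ * zetaS τ := by
  obtain ⟨f, hf⟩ := exists_isLogZeta hRH
  obtain ⟨R, hR, c₂, hc₂, B, hB, hlower⟩ := exists_lower_bound_im_sum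
  obtain ⟨C₁, hC₁, hformula⟩ := exists_norm_integral_sub_sum_le
  obtain ⟨C₄, hC₄, hcard⟩ := exists_card_vonMangoldt_ne_zero_le
  have hR' : (1 : ℝ) ≤ R := by exact_mod_cast hR
  set D : ℝ := C₄ * R + 1 with hDdef
  have hD : 1 ≤ D := by
    have : 0 ≤ C₄ * R := by positivity
    linarith
  have hpi := Real.pi_pos
  -- Chosen so that the assumed bound on `S`, times the kernel mass `2√(2π)`, is exactly `c₂ Q / 2`,
  -- half of the main term.
  set c : ℝ := c₂ / (4 * Real.sqrt (2 * Real.pi) * Real.pi * Real.sqrt (24 * D)) with hc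
  have hc0 : 0 < c := by positivity
  refine ⟨c, hc0, fun θ hθ T => ?_⟩
  by_contra! hcon
  set E₀ : ℝ := 2 * C₁ * (6 * 64 ^ 3) with hE₀
  -- `2T` keeps the window above `T`; the last entry, with `Q ≥ w/4`, makes `c₂ Q / 2` exceed the
  -- errors `B + E₀`.
  obtain ⟨w, hw⟩ := exists_nat_ge (max (max 10 (2 * T)) (8 * (B + E₀ + 1) / c₂))
  have hw10' : (10 : ℝ) ≤ w := (le_max_left _ _).trans ((le_max_left _ _).trans hw)
  have hw10 : 10 ≤ w := by exact_mod_cast hw10'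
  have hwT : 2 * T ≤ w := (le_max_right _ _).trans ((le_max_left _ _).trans hw)
  have hwB : 8 * (B + E₀ + 1) / c₂ ≤ w := (le_max_right _ _).trans hw
  obtain ⟨N, hN⟩ : ∃ N : ℕ, N = w ^ 4 := ⟨_, rfl⟩
  have hNw : (N : ℝ) = (w : ℝ) ^ 4 := by rw [hN]; push_cast; rfl
  have hNw' : (w : ℝ) ≤ N := by rw [hNw]; exact le_self_pow₀ (by linarith) (by norm_num)
  have hN100 : 100 ≤ N := by
    have : 10 ^ 4 ≤ w ^ 4 := Nat.pow_le_pow_left hw10 4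
    omega
  have hN100' : (100 : ℝ) ≤ N := by exact_mod_cast hN100
  have hlog4 := log_pow_four_le hw10
  rw [← hN] at hlog4
  obtain ⟨L, hL⟩ : ∃ L : ℝ, L = Real.log (N : ℝ) := ⟨_, rfl⟩
  rw [← hL] at hlog4
  have hL1 : 1 ≤ L := by
    rw [hL, Real.le_log_iff_exp_le (by linarith)]
    have := Real.exp_one_lt_d9
    linarith
  obtain ⟨z, hz⟩ : ∃ z : ℝ, z = (N : ℝ) / L := ⟨_, rfl⟩
  have hz1 : 1 ≤ z := by
    rw [hz, le_div_iff₀ (by linarith), one_mul]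
    have := Real.log_le_sub_one_of_pos (show (0 : ℝ) < N by linarith)
    linarith
  -- `m` bounds the number of prime powers up to `RN`, so with `Y = 6^m` the approximation gives `Y
  -- ≤ t ≤ Y²`.
  obtain ⟨m, hm⟩ : ∃ m : ℕ, m = ⌈D * z⌉₊ := ⟨_, rfl⟩
  have hmD : D * z ≤ m := hm ▸ Nat.le_ceil _
  have hzD : z ≤ D * z := le_mul_of_one_le_left (by linarith) hD
  have hmz : z ≤ m := hzD.trans hmD
  have hmD' : (m : ℝ) ≤ 2 * D * z := by
    have := (Nat.ceil_lt_add_one (show 0 ≤ D * z by linarith)).le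
    rw [← hm] at this
    linarith
  have hmz' : ((w ^ 4 : ℕ) : ℝ) / Real.log ((w ^ 4 : ℕ) : ℝ) ≤ m := by rwa [← hN, ← hL, ← hz]
  have hmD'' : (m : ℝ) ≤ 2 * D * (((w ^ 4 : ℕ) : ℝ) / Real.log ((w ^ 4 : ℕ) : ℝ)) := by
    rwa [← hN, ← hL, ← hz]
  obtain ⟨Y, hY⟩ : ∃ Y : ℝ, Y = 6 ^ m := ⟨_, rfl⟩
  have hYN : (N : ℝ) ≤ Y := by
    rw [hY, hN]
    exact pow_four_le_six_pow hw10 hmz'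
  have hY100 : 100 ≤ Y := hN100'.trans hYN
  set P := (Finset.Ioc 0 (R * N)).filter fun n => Λ n ≠ 0 with hP
  have hPm : P.card ≤ m := by
    have h1 := hcard (R * N) (le_trans (by omega) (Nat.le_mul_of_pos_left N hR))
    have h2 : ((R * N : ℕ) : ℝ) / Real.log ((R * N : ℕ) : ℝ) ≤ R * z := by
      have h3 : L ≤ Real.log ((R * N : ℕ) : ℝ) :=
        hL ▸ Real.log_le_log (by linarith) (by
        push_cast
        exact le_mul_of_one_le_left (by linarith) hR')
      calc _ ≤ ((R * N : ℕ) : ℝ) / L := by gcongr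
        _ = R * z := by rw [hz]; push_cast; ring
    have h4 : (P.card : ℝ) ≤ m := by
      refine h1.trans (le_trans ?_ hmD)
      calc _ ≤ C₄ * (R * z) := by gcongr
        _ ≤ D * z := by rw [hDdef]; linarith
    exact_mod_cast h4
  obtain ⟨t, ht1, ht2, hcos⟩ := exists_half_le_cos P (show 0 < Y by linarith)
  have htY : t ≤ Y ^ 2 := by
    refine ht2.trans ?_
    rw [sq]
    have : (6 : ℝ) ^ P.card ≤ Y := hY ▸ pow_le_pow_right₀ (by norm_num) hPm
    gcongr
  obtain ⟨l, hl⟩ : ∃ l : ℝ, l = θ * L := ⟨_, rfl⟩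
  have hlabs : |l| = L := by
    rw [hl, abs_mul, abs_of_pos (show 0 < L by linarith)]
    rcases hθ with rfl | rfl <;> simp
  obtain ⟨b, hb1, hb2, hb3⟩ := exists_sin_mul_eq_neg_one (l := l) (by rw [hlabs]; exact hL1) (Y / 4)
  -- The left end point is the negative of a point found for `-l`.
  obtain ⟨a', ha1, ha2, ha3⟩ := exists_sin_mul_eq_neg_one (l := -l)
    (by rw [abs_neg, hlabs]; exact hL1) (Y / 4)
  obtain ⟨a, ha⟩ : ∃ a : ℝ, a = -a' := ⟨_, rfl⟩
  have ha3' : Real.sin (l * a) = -1 := by rw [ha, mul_neg, ← neg_mul]; exact ha3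
  have hab : a ≤ b := by linarith
  have hta : Y / 2 ≤ t + a := by linarith
  have htb : t + b ≤ 2 * Y ^ 2 := by
    have := le_self_pow₀ (show 1 ≤ Y by linarith) two_ne_zero
    linarith
  obtain ⟨Q, hQ⟩ : ∃ Q : ℝ, Q = (w : ℝ) ^ 2 / L := ⟨_, rfl⟩
  have hQeq : Real.exp (L / 2) / L = Q := by
    have : L / 2 = Real.log ((w : ℝ) ^ 2) := by
      rw [hL, hNw, Real.log_pow, Real.log_pow]; push_cast; ring
    rw [this, Real.exp_log (by positivity), hQ]
  have hQw : (w : ℝ) / 4 ≤ Q := by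
    rw [hQ, le_div_iff₀ (by linarith)]
    calc (w : ℝ) / 4 * L ≤ w / 4 * (4 * w) := by gcongr
      _ = (w : ℝ) ^ 2 := by ring
  have hQ0 : 0 ≤ Q := le_trans (by linarith) hQw
  have hmain := hf.le_mul_integral_of_zetaS_le (t := t) (a := a) (b := b) (l := l) (σ := -θ)
    (B := Real.pi * (c * (Real.sqrt (24 * D) * Q))) (V := c₂ * Q - B - E₀)
    (η₀ := min (1 / 2) (Real.log 2 / L)) (by linarith) hab
    (lt_min (by norm_num) (div_pos (Real.log_pos one_lt_two) (by linarith))) ?_ ?_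
  · have hint := integral_sineGaussianReal_le l hab
    have h1 : c₂ * Q - B - E₀ ≤ Real.pi * (c * (Real.sqrt (24 * D) * Q)) *
        (2 * Real.sqrt (2 * Real.pi)) :=
      hmain.trans (mul_le_mul_of_nonneg_left hint (by positivity))
    have h2 : Real.pi * (c * (Real.sqrt (24 * D) * Q)) * (2 * Real.sqrt (2 * Real.pi)) =
        c₂ * Q / 2 := by
      rw [hc]
      have : Real.sqrt (24 * D) ≠ 0 := by positivity
      have : Real.sqrt (2 * Real.pi) ≠ 0 := by positivity
      field_simp
      norm_num
    rw [h2] at h1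
    rw [div_le_iff₀ hc₂] at hwB
    have h3 := mul_le_mul_of_nonneg_left hQw hc₂.le
    linarith
  · intro x hx hord
    have h1 := hcon (t + x) (by linarith [hx.1])
    have h2 := sqrt_log_div_log_log_le hw10 (τ := t + x) hD hmz' hmD''
      (by rw [← hY]; linarith [hx.1]) (by rw [← hY]; linarith [hx.2])
    rw [← hN, ← hL, ← hQ] at h2
    have h3 : -θ * zetaS (t + x) ≤ c * (Real.sqrt (24 * D) * Q) :=
      h1.le.trans (mul_le_mul_of_nonneg_left h2 hc0.le)
    calc -θ * (Real.pi * zetaS (t + x)) = Real.pi * (-θ * zetaS (t + x)) := by ring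
      _ ≤ _ := by gcongr
  · intro η hη
    have hη2 : η ≤ 1 / 2 := hη.2.le.trans (min_le_left _ _)
    have hηL : η * L ≤ Real.log 2 := by
      have := hη.2.le.trans (min_le_right _ _)
      rwa [le_div_iff₀ (by linarith)] at this
    obtain ⟨hsum, hdiff⟩ := hformula f hf t l a b η (Y / 4) hη.1 hη2 (by linarith) (by linarith)
      hb1 (by linarith) ha3' hb3
    have hlow := hlower N hN100 θ hθ η t hη.1.le (hL ▸ hηL) hcos (by rw [← hL, ← hl]; exact hsum)
    rw [← hL, ← hl, hQeq] at hlow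
    rw [← hf.im_integral_mul_sineGaussian hη.1 (by linarith) hab]
    set Z := ∫ x in a..b, f ((1 / 2 + η : ℝ) + (t + x : ℝ) * Complex.I) * sineGaussian l x
    set S := ∑' n : ℕ, (logZetaCoeff n : ℂ) *
        (Complex.exp (-((1 / 2 + η : ℝ) + t * Complex.I) * (Real.log n : ℝ)) *
          sineGaussianHat l (Real.log n))
    -- Here `e^{4|l|} = N⁴ ≤ Y⁴` and `t + b ≤ 2Y²`, so the Gaussian only has to beat `Y⁶`.
    have herr : C₁ * (t + b) * Real.exp (4 * |l|) * Real.exp (-(Y / 4) ^ 2 / 4) ≤ E₀ := by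
      have e1 : Real.exp (4 * |l|) = (N : ℝ) ^ 4 := by
        rw [hlabs, show (4 : ℝ) * L = ((4 : ℕ) : ℝ) * L by norm_num, Real.exp_nat_mul, hL,
          Real.exp_log (by linarith)]
      have e2 : -(Y / 4) ^ 2 / 4 = -Y ^ 2 / 64 := by ring
      rw [e1, e2]
      calc C₁ * (t + b) * (N : ℝ) ^ 4 * Real.exp (-Y ^ 2 / 64) ≤
            C₁ * (2 * Y ^ 2) * Y ^ 4 * Real.exp (-Y ^ 2 / 64) := by gcongr
        _ = 2 * C₁ * (Y ^ 6 * Real.exp (-Y ^ 2 / 64)) := by ring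
        _ ≤ E₀ := by
          rw [hE₀]
          exact mul_le_mul_of_nonneg_left (pow_six_mul_exp_neg_le Y) (by positivity)
    have him : |(Z - S).im| ≤ E₀ := (Complex.abs_im_le_norm _).trans (hdiff.trans herr)
    rw [Complex.sub_im, abs_le] at him
    rcases hθ with rfl | rfl <;> linarith

theorem mainTheorem4 (hRH : RiemannHypothesis) :
    IsOmegaPlusMinus zetaS (fun t : ℝ => Real.sqrt (Real.log t / Real.log (Real.log t))) := by
  obtain ⟨c, hc, h⟩ := exists_zetaS_large hRH
  refine ⟨c, hc, frequently_atTop.2 fun T => ?_, frequently_atTop.2 fun T => ?_⟩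
  -- The sign is reversed: frequency `l = -log N` produces large positive values of `S`.
  · obtain ⟨τ, hτ, h1⟩ := h (-1) (Or.inr rfl) T
    exact ⟨τ, hτ, by simpa using h1⟩
  · obtain ⟨τ, hτ, h1⟩ := h 1 (Or.inl rfl) T
    exact ⟨τ, hτ, by linarith⟩
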